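/- Let $|\cdot|$ be Lebesgue measure on $[0,1]$ and $\mathbb E g=\int_0^1 g(x)\,dx$. An interval $\sigma$-algebra $\mathscr F$ is a $\sigma$-algebra on $[0,1]$ generated by a finite partition of $[0,1]$ into intervals of positive length (its atoms). For a positive integer $k$, let $\mathscr S_k(\mathscr F)$ be the space of all $f\in C^{k-2}[0,1]$ (no smoothness condition if $k=1$) that coincide on each atom of $\mathscr F$ with a polynomial of degree at most $k-1$. Let $(N_i)$ be the B-spline basis of $\mathscr S_k(\mathscr F)$, ordered from left to right (the knots are the end points of the atoms, with $0$ and $1$ repeated $k$ times, and the $N_i$ are normalized to form a partition of unity), let $E_i$ be the support of $N_i$, and put $$\gamma_k(\mathscr F)=\max_i\max\big(|E_i|/|E_{i+1}|,\ |E_{i+1}|/|E_i|\big),$$ the maximum being over all $i$ for which $E_i$ and $E_{i+1}$ are both defined (with value $0$ if there is no such $i$). Let $P_{\mathscr F}$ be the orthogonal projection onto $\mathscr S_k(\mathscr F)$ with respect to the inner product of $L_2[0,1]$, extended to $L_1[0,1]$: $P_{\mathscr F}g$ is the element of $\mathscr S_k(\mathscr F)$ with $\mathbb E[(P_{\mathscr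 F}g)s]=\mathbb E[gs]$ for all $s\in\mathscr S_k(\mathscr F)$. **Theorem.** For every positive integer $k$ and every real $\gamma\ge 0$ there is a constant $C=C(k,\gamma)<\infty$ such that the following holds. Let $(\mathscr F_n)_{n\ge1}$ be an increasing sequence of interval $\sigma$-algebras on $[0,1]$ with $\sup_n\gamma_k(\mathscr F_n)\le\gamma$, let $P_n=P_{\mathscr F_n}$, let $f_n\in\mathscr S_k(\mathscr F_n)$ and let $h_n\in L_1[0,1]$ be arbitrary real-valued functions, $n\ge 1$. Then, for every $N$, $$\sum_{n=1}^N\mathbb E\big[|f_n h_n|\big]\le C\cdot\mathbb E\Big[\Big(\sum_{\ell=1}^N f_\ell^2\Big)^{1/2}\Big]\cdot\sup_{1\le n\le N}\Big\|P_n\Big(\sum_{\ell=n}^N h_\ell^2\Big)\Big\|_\infty^{1/2}.$$ Here $\|P_n g\|_\infty$ is read as $+\infty$ if $g=\sum_{\ell=n}^N h_\ell^2$ is not integrable, $0\cdot\infty=0$, and for $N=0$ both sides are $0$. -/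

import Mathlib

open MeasureTheory Set
open scoped ENNReal NNReal Polynomial

/-- A finite partition of `[0,1]` into `numAtoms` intervals of positive length, listed from left to
right. The `i`-th interval `atom i` has end points `knot i < knot (i+1)`; each of the end points may
or may not belong to it. -/
structure IntervalPartition where
  numAtoms : ℕ
  knot : Fin (numAtoms + 1) → ℝ
  strictMono_knot : StrictMono knot
  knot_zero : knot 0 = 0
  knot_last : knot (Fin.last numAtoms) = 1
  atom : Fin numAtoms → Set ℝ
  Ioo_subset_atom : ∀ i, Ioo (knot i.castSucc) (knot i.succ) ⊆ atom i
  atom_subset_Icc : ∀ i, atom i ⊆ Icc (knot i.castSucc) (knot i.succ)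
  disjoint_atom : Pairwise fun i j => Disjoint (atom i) (atom j)
  iUnion_atom : ⋃ i, atom i = Icc 0 1

namespace IntervalPartition

/-- The interval `σ`-algebra on `[0,1]` generated by the partition. -/
@[reducible]
def sigmaAlgebra (F : IntervalPartition) : MeasurableSpace (Icc (0 : ℝ) 1) :=
  MeasurableSpace.generateFrom (range fun i : Fin F.numAtoms => Subtype.val ⁻¹' F.atom i)

/-- The spline space of order `k`: functions that are `C^{k-2}` on `[0,1]` (no smoothness is
required for `k = 1`) and that agree on each atom with a polynomial of order `k`, i.e. of degree
less than `k`. Only the values on `[0,1]` matter. -/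
def splineSpace (F : IntervalPartition) (k : ℕ) : Submodule ℝ (ℝ → ℝ) where
  carrier := {f | (2 ≤ k → ContDiffOn ℝ ((k - 2 : ℕ) : WithTop ℕ∞) f (Icc 0 1)) ∧
    ∀ i, ∃ p : ℝ[X], p.degree < (k : WithBot ℕ) ∧ ∀ x ∈ F.atom i, f x = p.eval x}
  zero_mem' := ⟨fun _ => contDiffOn_const, fun _ =>
    ⟨0, by rw [Polynomial.degree_zero]; exact WithBot.bot_lt_coe k, fun _ _ => by simp⟩⟩
  add_mem' := by
    rintro f g ⟨hf, hf'⟩ ⟨hg, hg'⟩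
    refine ⟨fun hk => (hf hk).add (hg hk), fun i => ?_⟩
    obtain ⟨p, hp, hp'⟩ := hf' i
    obtain ⟨q, hq, hq'⟩ := hg' i
    exact ⟨p + q, (Polynomial.degree_add_le p q).trans_lt (max_lt hp hq), fun x hx => by
      simp [hp' x hx, hq' x hx]⟩
  smul_mem' := by
    rintro c f ⟨hf, hf'⟩
    refine ⟨fun hk => (contDiffOn_const (c := c)).smul (hf hk), fun i => ?_⟩
    obtain ⟨p, hp, hp'⟩ := hf' i
    exact ⟨c • p, (Polynomial.degree_smul_le c p).trans_lt hp, fun x hx => by simp [hp' x hx]⟩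

/-- The knot sequence for splines of order `k`: the knots of the partition, where the end points
`0` and `1` are repeated `k` times (and `1` forever after). -/
def extKnot (F : IntervalPartition) (k i : ℕ) : ℝ :=
  F.knot ⟨min (i - (k - 1)) F.numAtoms, by omega⟩

/-- B-splines over `extKnot F k`, by the Cox-de Boor recursion, with `0 / 0 = 0`: the function
`bsplineAux F k r i` is the `i`-th B-spline of order `r + 1`, it belongs to the knots
`extKnot F k i, …, extKnot F k (i + r + 1)`. The B-splines of order `1` are the indicator functions
of the atoms, and `0` where consecutive knots coincide. -/
noncomputable def bsplineAux (F : IntervalPartition) (k : ℕ) : ℕ → ℕ → ℝ → ℝ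
  | 0, i, x =>
    if h : k - 1 ≤ i ∧ i - (k - 1) < F.numAtoms then
      (F.atom ⟨i - (k - 1), h.2⟩).indicator 1 x
    else 0
  | r + 1, i, x =>
    (x - F.extKnot k i) / (F.extKnot k (i + r + 1) - F.extKnot k i) * bsplineAux F k r i x +
    (F.extKnot k (i + r + 2) - x) / (F.extKnot k (i + r + 2) - F.extKnot k (i + 1)) *
      bsplineAux F k r (i + 1) x

/-- The B-spline basis `N_0, …, N_{m+k-2}` of the spline space of order `k ≥ 1` of a partition
with `m` atoms. -/
noncomputable def bspline (F : IntervalPartition) (k i : ℕ) : ℝ → ℝ :=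
  F.bsplineAux k (k - 1) i

/-- The support `E_i` of the B-spline `N_i`. -/
def bsplineSupport (F : IntervalPartition) (k i : ℕ) : Set ℝ :=
  tsupport (F.bspline k i)

/-- The `k`-regularity parameter: the maximum of the ratios `|E_i| / |E_{i+1}|` and
`|E_{i+1}| / |E_i|` over all pairs of consecutive B-splines. -/
noncomputable def regularity (F : IntervalPartition) (k : ℕ) : ℝ≥0∞ :=
  ⨆ i ∈ Finset.range (F.numAtoms + k - 2),
    max (volume (F.bsplineSupport k i) / volume (F.bsplineSupport k (i + 1)))
      (volume (F.bsplineSupport k (i + 1)) / volume (F.bsplineSupport k i))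

/-- `p` is the orthogonal projection of `g` onto the spline space, with respect to the inner
product of `L_2[0,1]`. -/
def IsSplineProj (F : IntervalPartition) (k : ℕ) (g p : ℝ → ℝ) : Prop :=
  p ∈ F.splineSpace k ∧
    ∀ s ∈ F.splineSpace k, ∫ x in Icc (0 : ℝ) 1, p x * s x = ∫ x in Icc (0 : ℝ) 1, g x * s x

theorem measurableSet_atom (F : IntervalPartition) (i : Fin F.numAtoms) :
    MeasurableSet (F.atom i) := by
  have h : F.atom i = Ioo (F.knot i.castSucc) (F.knot i.succ) ∪
      (F.atom i ∩ {F.knot i.castSucc, F.knot i.succ}) := by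
    ext x
    have h1 : x ∈ Ioo _ _ → x ∈ F.atom i := fun h => F.Ioo_subset_atom i h
    have h2 : x ∈ F.atom i → x ∈ Icc _ _ := fun h => F.atom_subset_Icc i h
    simp only [mem_Ioo, mem_Icc, mem_union, mem_inter_iff, mem_insert_iff,
      mem_singleton_iff] at *
    constructor
    · intro hx
      rcases eq_or_lt_of_le (h2 hx).1 with h3 | h3
      · exact Or.inr ⟨hx, Or.inl h3.symm⟩
      · rcases eq_or_lt_of_le (h2 hx).2 with h4 | h4
        · exact Or.inr ⟨hx, Or.inr h4⟩
        · exact Or.inl ⟨h3, h4⟩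
    · rintro (hx | hx)
      · exact h1 hx
      · exact hx.1
  rw [h]
  exact measurableSet_Ioo.union ((toFinite _).inter_of_right _).measurableSet

/-- The piecewise polynomial function on `[0,1]` with given polynomials on the atoms. -/
noncomputable def piecewisePoly (F : IntervalPartition) (k : ℕ) :
    (Fin F.numAtoms → Polynomial.degreeLT ℝ k) →ₗ[ℝ] (ℝ → ℝ) where
  toFun q := fun x => ∑ i, (F.atom i).indicator (fun x => (q i : ℝ[X]).eval x) x
  map_add' q r := by
    ext x
    simp only [Pi.add_apply, Submodule.coe_add, Polynomial.eval_add]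
    rw [← Finset.sum_add_distrib]
    exact Finset.sum_congr rfl fun i _ => by
      by_cases h : x ∈ F.atom i <;> simp [h]
  map_smul' c q := by
    ext x
    simp only [Pi.smul_apply, Submodule.coe_smul, Polynomial.eval_smul, RingHom.id_apply]
    rw [Finset.smul_sum]
    exact Finset.sum_congr rfl fun i _ => by
      by_cases h : x ∈ F.atom i <;> simp [h]

theorem piecewisePoly_apply (F : IntervalPartition) {k : ℕ}
    (q : Fin F.numAtoms → Polynomial.degreeLT ℝ k) {i : Fin F.numAtoms} {x : ℝ}
    (hx : x ∈ F.atom i) : F.piecewisePoly k q x = (q i : ℝ[X]).eval x := by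
  change ∑ j, (F.atom j).indicator (fun x => (q j : ℝ[X]).eval x) x = _
  rw [Finset.sum_eq_single i]
  · simp [hx]
  · intro j _ hj
    exact indicator_of_notMem (fun h => (F.disjoint_atom hj).le_bot ⟨h, hx⟩) _
  · simp

theorem measurable_piecewisePoly (F : IntervalPartition) {k : ℕ}
    (q : Fin F.numAtoms → Polynomial.degreeLT ℝ k) : Measurable (F.piecewisePoly k q) := by
  change Measurable fun x => ∑ i, (F.atom i).indicator (fun x => (q i : ℝ[X]).eval x) x
  exact Finset.measurable_sum _ fun i _ =>
    (Polynomial.continuous (q i : ℝ[X])).measurable.indicator (F.measurableSet_atom i)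

theorem bounded_piecewisePoly (F : IntervalPartition) {k : ℕ}
    (q : Fin F.numAtoms → Polynomial.degreeLT ℝ k) :
    ∃ C, ∀ x, ‖F.piecewisePoly k q x‖ ≤ C := by
  have h : ∀ i, ∃ C, ∀ x ∈ Icc (0 : ℝ) 1, ‖(q i : ℝ[X]).eval x‖ ≤ C := fun i =>
    isCompact_Icc.exists_bound_of_continuousOn (Polynomial.continuous (q i : ℝ[X])).continuousOn
  choose C hC using h
  refine ⟨∑ i, C i, fun x => ?_⟩
  change ‖∑ i, (F.atom i).indicator (fun x => (q i : ℝ[X]).eval x) x‖ ≤ ∑ i, C i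
  refine (norm_sum_le _ _).trans (Finset.sum_le_sum fun i _ => ?_)
  have h0 : 0 ≤ C i := (norm_nonneg _).trans (hC i 0 (by simp))
  by_cases hx : x ∈ F.atom i
  · have : x ∈ Icc (0 : ℝ) 1 := by
      rw [← F.iUnion_atom]; exact mem_iUnion.2 ⟨i, hx⟩
    simpa [hx] using hC i x this
  · simpa [hx] using h0

/-- Every spline agrees on `[0,1]` with one that vanishes outside of `[0,1]`. -/
theorem exists_piecewisePoly (F : IntervalPartition) {k : ℕ} {s : ℝ → ℝ}
    (hs : s ∈ F.splineSpace k) :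
    ∃ t ∈ LinearMap.range (F.piecewisePoly k) ⊓ F.splineSpace k, EqOn s t (Icc 0 1) := by
  choose p hp hp' using hs.2
  set q : Fin F.numAtoms → Polynomial.degreeLT ℝ k :=
    fun i => ⟨p i, Polynomial.mem_degreeLT.2 (hp i)⟩
  have he : EqOn s (F.piecewisePoly k q) (Icc 0 1) := by
    intro x hx
    rw [← F.iUnion_atom] at hx
    obtain ⟨i, hi⟩ := mem_iUnion.1 hx
    rw [F.piecewisePoly_apply q hi, hp' i x hi]
  refine ⟨F.piecewisePoly k q, ⟨⟨q, rfl⟩, fun hk => (hs.1 hk).congr he.symm, fun i => ?_⟩, he⟩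
  exact ⟨p i, hp i, fun x hx => F.piecewisePoly_apply q hx⟩

/-- The orthogonal projection is defined on all of `L_1[0,1]`. -/
theorem exists_isSplineProj (F : IntervalPartition) (k : ℕ) {g : ℝ → ℝ}
    (hg : IntegrableOn g (Icc 0 1)) : ∃ p, F.IsSplineProj k g p := by
  set V : Submodule ℝ (ℝ → ℝ) := LinearMap.range (F.piecewisePoly k) ⊓ F.splineSpace k
  have : FiniteDimensional ℝ V :=
    Submodule.finiteDimensional_of_le (inf_le_left : V ≤ LinearMap.range (F.piecewisePoly k))
  have hmul : ∀ (f : ℝ → ℝ) (s : V), IntegrableOn f (Icc 0 1) →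
      IntegrableOn (fun x => f x * (s : ℝ → ℝ) x) (Icc 0 1) := by
    rintro f ⟨s, ⟨q, rfl⟩, _⟩ hf
    obtain ⟨C, hC⟩ := F.bounded_piecewisePoly q
    exact hf.mul_bdd (F.measurable_piecewisePoly q).aestronglyMeasurable
      (Filter.Eventually.of_forall hC)
  have hV : ∀ s : V, IntegrableOn (s : ℝ → ℝ) (Icc 0 1) := fun s => by
    simpa using hmul (fun _ => 1) s (by simp)
  let B : V →ₗ[ℝ] Module.Dual ℝ V := LinearMap.mk₂ ℝ
    (fun f s => ∫ x in Icc (0 : ℝ) 1, (f : ℝ → ℝ) x * (s : ℝ → ℝ) x)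
    (fun f f' s => by
      simp only [Submodule.coe_add, Pi.add_apply, add_mul]
      exact integral_add (hmul _ _ (hV f)) (hmul _ _ (hV f')))
    (fun c f s => by
      simp only [Submodule.coe_smul, Pi.smul_apply, smul_eq_mul, mul_assoc]
      exact integral_const_mul _ _)
    (fun f s s' => by
      simp only [Submodule.coe_add, Pi.add_apply, mul_add]
      exact integral_add (hmul _ _ (hV f)) (hmul _ _ (hV f)))
    (fun c f s => by
      simp only [Submodule.coe_smul, Pi.smul_apply, smul_eq_mul, mul_left_comm _ c]
      exact integral_const_mul _ _)
  let φ : Module.Dual ℝ V :=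
    { toFun := fun s => ∫ x in Icc (0 : ℝ) 1, g x * (s : ℝ → ℝ) x
      map_add' := fun s s' => by
        simp only [Submodule.coe_add, Pi.add_apply, mul_add]
        exact integral_add (hmul _ _ hg) (hmul _ _ hg)
      map_smul' := fun c s => by
        simp only [Submodule.coe_smul, Pi.smul_apply, smul_eq_mul, mul_left_comm _ c,
          RingHom.id_apply]
        exact integral_const_mul _ _ }
  have hφ : φ ∈ LinearMap.range B.dualMap := by
    rw [LinearMap.range_dualMap_eq_dualAnnihilator_ker, Submodule.mem_dualAnnihilator]
    intro s hs
    have h0 : ∫ x in Icc (0 : ℝ) 1, (s : ℝ → ℝ) x * (s : ℝ → ℝ) x = 0 :=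
      LinearMap.congr_fun (LinearMap.mem_ker.1 hs) s
    rw [integral_eq_zero_iff_of_nonneg (fun x => mul_self_nonneg _) (hmul _ _ (hV s))] at h0
    refine integral_eq_zero_of_ae ?_
    filter_upwards [h0] with x hx
    simp only [Pi.zero_apply, mul_self_eq_zero] at hx
    simp [hx]
  obtain ⟨ψ, hψ⟩ := hφ
  obtain ⟨p, rfl⟩ := (Module.evalEquiv ℝ V).surjective ψ
  refine ⟨p, p.2.2, fun s hs => ?_⟩
  obtain ⟨t, ht, hst⟩ := F.exists_piecewisePoly hs
  have h1 : ∫ x in Icc (0 : ℝ) 1, t x * (p : ℝ → ℝ) x = ∫ x in Icc (0 : ℝ) 1, g x * t x :=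
    LinearMap.congr_fun hψ ⟨t, ht⟩
  calc ∫ x in Icc (0 : ℝ) 1, (p : ℝ → ℝ) x * s x
      = ∫ x in Icc (0 : ℝ) 1, t x * (p : ℝ → ℝ) x :=
        setIntegral_congr_fun measurableSet_Icc fun x hx => by simp [hst hx, mul_comm]
    _ = ∫ x in Icc (0 : ℝ) 1, g x * t x := h1
    _ = ∫ x in Icc (0 : ℝ) 1, g x * s x :=
        setIntegral_congr_fun measurableSet_Icc fun x hx => by simp [hst hx]

/-- The orthogonal projection operator onto the spline space of order `k`, on `L_1[0,1]`. -/
noncomputable def splineProj (F : IntervalPartition) (k : ℕ) (g : ℝ → ℝ)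
    (hg : IntegrableOn g (Icc 0 1)) : ℝ → ℝ :=
  (F.exists_isSplineProj k hg).choose

open Classical in
/-- The `L_∞[0,1]` norm of the projection of `g`, for `g` in `L_1[0,1]`. The value is `∞` if `g`
is not integrable. -/
noncomputable def splineProjSupNorm (F : IntervalPartition) (k : ℕ) (g : ℝ → ℝ) : ℝ≥0∞ :=
  if hg : IntegrableOn g (Icc 0 1) then
    eLpNorm (F.splineProj k g hg) ∞ (volume.restrict (Icc 0 1))
  else ∞

end IntervalPartition

/-!
The classical proof for martingales writes `X n` for the sum of the squares of the first `n`
functions, splits `|f n * h n|` with the weight `√(X n)`, uses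
`f n ^ 2 / √(X n) ≤ 2 * (√(X n) - √(X (n - 1)))` on one part and Abel summation on the other; the
increments of `√(X n)` are measurable, so they only see the conditional expectations of the tails
of `∑ h l ^ 2`. Here the increments of `√(X n)` are not splines. The proof replaces them by
nonnegative splines `y n` from the `n`-th spline space, such that `√(X n)` is at most a constant
times `∑ j ≤ n, y j` and such that the integrals of the `y n` add up to at most a constant times the
integral of `√(X N)` (`IntervalPartition.exists_spline_majorant`). The integral of `y n` against a
function only depends on the projection of the function, and since `y n ≥ 0` it is bounded by the
sup norm of the projection. No bound on the norm of the projections is needed.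

The splines `y n` come from a stopping time argument on dominant atoms, that is, atoms which are
longest in the support of some B-spline. Three facts make it work.

* The values of a spline are controlled by its values at a few points of the dominant atoms nearby
  (`IntervalPartition.exists_sq_le_sum_node`). The B-spline coefficients are blossoms of the
  polynomial pieces, which do not depend on the piece chosen inside the support, and de Boor's
  algorithm recovers the spline from them by averaging. Blossoms are encoded by the apolar pairing
  of polynomials.
* Around a dominant atom there is a bump in the spline space
  (`IntervalPartition.exists_bump_mem_splineSpace`), whose integral is comparable to the length of
  the atom because of the regularity of the partition
  (`IntervalPartition.gridPoint_sub_le_of_isDominant`).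
* A polynomial is comparable to its maximum on a fixed proportion of an interval
  (`Polynomial.exists_subinterval_abs_eval_le`), so that the increments of the running maximum over
  dominant atoms are visible in the final square function on a fixed proportion of each atom.
-/

/-! ### Polynomials of bounded degree on an interval -/

namespace Polynomial

/-- A weak form of Remez' inequality: on some subinterval of proportional length, a polynomial is
comparable to its maximum over the whole interval. -/
theorem exists_subinterval_abs_eval_le (D : ℕ) {q : ℝ[X]} (hq : q.degree < (D + 1 : ℕ))
    {u ℓ : ℝ} (hℓ : 0 < ℓ) :
    ∃ v, u ≤ v ∧ v + ℓ / (2 * D + 1) ≤ u + ℓ ∧ ∀ x ∈ Icc v (v + ℓ / (2 * D + 1)),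
      ∀ y ∈ Icc u (u + ℓ), |q.eval y| ≤ (D + 1) * (2 * D + 1) ^ D * |q.eval x| := by
  set h : ℝ := ℓ / (2 * D + 1) with hh
  have hD : (0 : ℝ) < 2 * D + 1 := by positivity
  have hh0 : 0 < h := by positivity
  have hℓh : ℓ = (2 * D + 1) * h := by rw [hh]; field_simp
  obtain ⟨y₀, hy₀, hmax⟩ := isCompact_Icc.exists_isMaxOn (nonempty_Icc.2 (by linarith : u ≤ u + ℓ))
    (q.continuous.abs.continuousOn)
  suffices H : ∃ i ∈ Finset.range (D + 1), ∀ x ∈ Icc (u + 2 * i * h) (u + 2 * i * h + h),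
      |q.eval y₀| ≤ (D + 1) * (2 * D + 1) ^ D * |q.eval x| by
    obtain ⟨i, hi, H⟩ := H
    have hi' : (i : ℝ) ≤ D := by exact_mod_cast Nat.lt_succ_iff.1 (Finset.mem_range.1 hi)
    refine ⟨u + 2 * i * h, by nlinarith [Nat.cast_nonneg (α := ℝ) i], ?_,
      fun x hx y hy => (hmax hy).trans (H x hx)⟩
    rw [hℓh]; nlinarith
  -- Otherwise each of `D + 1` separated subintervals contains a point where `q` is small, and
  -- Lagrange interpolation at these points bounds the maximum.
  by_contra! hcon
  have hcon' : ∀ i : ℕ, ∃ x, i ∈ Finset.range (D + 1) →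
      x ∈ Icc (u + 2 * i * h) (u + 2 * i * h + h) ∧
      (D + 1) * (2 * D + 1) ^ D * |q.eval x| < |q.eval y₀| := fun i => by
    by_cases hi : i ∈ Finset.range (D + 1)
    · obtain ⟨x, hx⟩ := hcon i hi
      exact ⟨x, fun _ => hx⟩
    · exact ⟨0, fun h => absurd h hi⟩
  choose v hv using hcon'
  have hsep : ∀ i ∈ Finset.range (D + 1), ∀ j ∈ Finset.range (D + 1), i ≠ j →
      h ≤ |v i - v j| := by
    have key : ∀ i ∈ Finset.range (D + 1), ∀ j ∈ Finset.range (D + 1), i < j →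
        h ≤ v j - v i := by
      intro i hi j hj hij
      have h1 := (hv i hi).1.2
      have h2 := (hv j hj).1.1
      have h3 : (i : ℝ) + 1 ≤ j := by exact_mod_cast hij
      nlinarith
    intro i hi j hj hij
    rcases lt_or_gt_of_ne hij with h1 | h1
    · rw [abs_sub_comm]; exact (key i hi j hj h1).trans (le_abs_self _)
    · exact (key j hj i hi h1).trans (le_abs_self _)
  have hinj : Set.InjOn v (Finset.range (D + 1) : Set ℕ) := by
    intro i hi j hj hij
    by_contra hne
    have := hsep i hi j hj hne
    rw [hij, sub_self, abs_zero] at this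
    linarith
  have hbasis : ∀ i ∈ Finset.range (D + 1),
      |(Lagrange.basis (Finset.range (D + 1)) v i).eval y₀| ≤ (2 * D + 1) ^ D := by
    intro i hi
    have hc : ((Finset.range (D + 1)).erase i).card = D := by
      rw [Finset.card_erase_of_mem hi]; simp
    rw [Lagrange.basis, eval_prod, Finset.abs_prod]
    refine (Finset.prod_le_prod (g := fun _ => (2 * D + 1 : ℝ)) (fun _ _ => abs_nonneg _)
      fun j hj => ?_).trans_eq (by rw [Finset.prod_const, hc])
    have hj' := Finset.mem_erase.1 hj
    have h1 := hsep i hi j hj'.2 hj'.1.symm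
    have h2 : |y₀ - v j| ≤ (2 * D + 1) * h := by
      have h3 := (hv j hj'.2).1
      have h4 : (j : ℝ) ≤ D := by exact_mod_cast Nat.lt_succ_iff.1 (Finset.mem_range.1 hj'.2)
      have h5 : (0 : ℝ) ≤ j := Nat.cast_nonneg j
      rw [hℓh] at hy₀
      rw [abs_le]
      constructor <;> nlinarith [h3.1, h3.2, hy₀.1, hy₀.2]
    simp only [Lagrange.basisDivisor, eval_mul, eval_C, eval_sub, eval_X, abs_mul, abs_inv]
    rw [inv_mul_le_iff₀ (by linarith)]
    nlinarith
  have hdeg : q.degree < ((Finset.range (D + 1)).card : WithBot ℕ) := by simpa using hq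
  have hint := congrArg (fun p : ℝ[X] => |p.eval y₀|) (Lagrange.eq_interpolate hinj hdeg)
  simp only [Lagrange.interpolate_apply, eval_finsetSum, eval_mul, eval_C] at hint
  have hlt : |q.eval y₀| < |q.eval y₀| := by
    calc |q.eval y₀| ≤ ∑ i ∈ Finset.range (D + 1),
          |q.eval (v i) * (Lagrange.basis (Finset.range (D + 1)) v i).eval y₀| :=
          hint.trans_le (Finset.abs_sum_le_sum_abs _ _)
      _ < ∑ i ∈ Finset.range (D + 1), |q.eval y₀| / (D + 1) := by
          refine Finset.sum_lt_sum_of_nonempty ⟨0, by simp⟩ fun i hi => ?_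
          rw [abs_mul, lt_div_iff₀ (by positivity)]
          have h1 := (hv i hi).2
          have h2 := hbasis i hi
          have h3 := abs_nonneg (q.eval (v i))
          calc _ ≤ |q.eval (v i)| * (2 * D + 1) ^ D * (D + 1) := by gcongr
            _ < _ := by linarith
      _ = |q.eval y₀| := by
          rw [Finset.sum_const, Finset.card_range, nsmul_eq_mul]; push_cast; field_simp
  exact lt_irrefl _ hlt

/-- The apolar pairing of polynomials of degree at most `d`, normalised so that pairing `p` with
`(x - X) ^ d` gives `p x`. Pairing with `∏ (uᵢ - X)` gives the blossom of `p` at the points `uᵢ`. -/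
noncomputable def apolar (d : ℕ) (p ψ : ℝ[X]) : ℝ :=
  ∑ r ∈ Finset.range (d + 1), p.coeff r * (ψ.coeff (d - r) * (-1) ^ (d - r) / d.choose r)

theorem apolar_add_left (d : ℕ) (p q ψ : ℝ[X]) :
    apolar d (p + q) ψ = apolar d p ψ + apolar d q ψ := by
  simp only [apolar, coeff_add, add_mul, Finset.sum_add_distrib]

theorem apolar_add_right (d : ℕ) (p ψ φ : ℝ[X]) :
    apolar d p (ψ + φ) = apolar d p ψ + apolar d p φ := by
  simp only [apolar, coeff_add, add_mul, mul_add, add_div, Finset.sum_add_distrib]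

theorem apolar_C_mul_right (d : ℕ) (c : ℝ) (p ψ : ℝ[X]) :
    apolar d p (C c * ψ) = c * apolar d p ψ := by
  simp only [apolar, coeff_C_mul, Finset.mul_sum]
  exact Finset.sum_congr rfl fun _ _ => by ring

theorem apolar_sum_right {ι : Type*} (d : ℕ) (p : ℝ[X]) (s : Finset ι) (ψ : ι → ℝ[X]) :
    apolar d p (∑ i ∈ s, ψ i) = ∑ i ∈ s, apolar d p (ψ i) := by
  classical
  induction s using Finset.induction_on with
  | empty => simp [apolar]
  | insert i s hi ih => rw [Finset.sum_insert hi, Finset.sum_insert hi, apolar_add_right, ih]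

theorem coeff_C_sub_X_pow (x : ℝ) (d r : ℕ) (hr : r ≤ d) :
    ((C x - X : ℝ[X]) ^ d).coeff (d - r) = (-1) ^ (d - r) * x ^ r * d.choose r := by
  have h : (C x - X : ℝ[X]) ^ d = C ((-1) ^ d) * (X + C (-x)) ^ d := by
    rw [C_pow, ← mul_pow]; congr 1; simp only [C_neg, C_1]; ring
  rw [h, coeff_C_mul, coeff_X_add_C_pow, Nat.sub_sub_self hr, Nat.choose_symm hr,
    neg_pow x, ← mul_assoc, ← mul_assoc, ← pow_add]
  congr 2
  rw [show d + r = (d - r) + 2 * r by omega, pow_add, pow_mul]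
  simp

theorem apolar_C_sub_X_pow {d : ℕ} {p : ℝ[X]} (hp : p.degree < (d + 1 : ℕ)) (x : ℝ) :
    apolar d p ((C x - X) ^ d) = p.eval x := by
  rw [eval_eq_sum_range' (n := d + 1)
    (by rw [Nat.lt_succ_iff]; exact natDegree_le_of_degree_le (Order.lt_succ_iff.1 hp)), apolar]
  refine Finset.sum_congr rfl fun r hr => ?_
  have hr' := Nat.lt_succ_iff.1 (Finset.mem_range.1 hr)
  have hc : (d.choose r : ℝ) ≠ 0 := by exact_mod_cast (Nat.choose_pos hr').ne'
  rw [coeff_C_sub_X_pow x d r hr']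
  have h1 : ((-1 : ℝ) ^ (d - r)) * (-1) ^ (d - r) = 1 := by rw [← mul_pow]; simp
  field_simp
  linear_combination (p.coeff r * x ^ r) * h1

theorem apolar_X_sub_C_pow {d : ℕ} {ψ : ℝ[X]} (hψ : ψ.natDegree ≤ d) (τ c : ℝ) :
    apolar d (C c * (X - C τ) ^ d) ψ = c * ψ.eval τ := by
  rw [eval_eq_sum_range' (n := d + 1) (by omega), apolar, ← Finset.sum_range_reflect,
    Finset.mul_sum]
  refine Finset.sum_congr rfl fun r hr => ?_
  have hr' := Nat.lt_succ_iff.1 (Finset.mem_range.1 hr)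
  have hc : (d.choose (d - r) : ℝ) ≠ 0 := by
    exact_mod_cast (Nat.choose_pos (Nat.sub_le d r)).ne'
  rw [show d + 1 - 1 - r = d - r by omega, coeff_C_mul, sub_eq_add_neg X, ← C_neg,
    coeff_X_add_C_pow, Nat.sub_sub_self hr', neg_pow τ]
  have h1 : ((-1 : ℝ) ^ r) * (-1) ^ r = 1 := by rw [← mul_pow]; simp
  field_simp
  linear_combination (c * ψ.coeff r * τ ^ r) * h1

/-- Powers of linear factors at `d + 1` distinct nodes span the polynomials of degree at most `d`,
with coefficients given by the apolar pairing with the Lagrange basis. -/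
theorem eq_sum_apolar_basis_mul {d : ℕ} {ψ : ℝ[X]} (hψ : ψ.natDegree ≤ d) {v : ℕ → ℝ}
    (hv : Set.InjOn v (Finset.range (d + 1) : Set ℕ)) :
    ψ = ∑ l ∈ Finset.range (d + 1),
      C (apolar d (Lagrange.basis (Finset.range (d + 1)) v l) ψ) * (C (v l) - X) ^ d := by
  ext n
  rcases lt_or_ge d n with hn | hn
  · rw [coeff_eq_zero_of_natDegree_lt (by omega), finsetSum_coeff]
    refine (Finset.sum_eq_zero fun l _ => ?_).symm
    rw [coeff_C_mul, coeff_eq_zero_of_natDegree_lt, mul_zero]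
    refine lt_of_le_of_lt natDegree_pow_le ?_
    have : (C (v l) - X : ℝ[X]).natDegree ≤ 1 := by
      refine (natDegree_sub_le _ _).trans ?_
      simp
    nlinarith
  · obtain ⟨r, hr, rfl⟩ : ∃ r ≤ d, n = d - r := ⟨d - n, Nat.sub_le _ _, by omega⟩
    have hmon : (X ^ r : ℝ[X]) = ∑ l ∈ Finset.range (d + 1),
        C ((v l) ^ r) * Lagrange.basis (Finset.range (d + 1)) v l := by
      have := Lagrange.eq_interpolate (f := (X ^ r : ℝ[X])) hv
        (by rw [degree_X_pow, Finset.card_range]; exact_mod_cast Nat.lt_succ_of_le hr)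
      simpa [Lagrange.interpolate_apply] using this
    have hcoe : ∀ s, ∑ l ∈ Finset.range (d + 1),
        (v l) ^ r * (Lagrange.basis (Finset.range (d + 1)) v l).coeff s =
          if s = r then 1 else 0 := fun s => by
      rw [← coeff_X_pow, hmon, finsetSum_coeff]
      simp only [coeff_C_mul]
    rw [finsetSum_coeff]
    simp only [coeff_C_mul, coeff_C_sub_X_pow _ d r hr, apolar, Finset.sum_mul]
    rw [Finset.sum_comm]
    have hc : (d.choose r : ℝ) ≠ 0 := by exact_mod_cast (Nat.choose_pos hr).ne'
    have h1 : ((-1 : ℝ) ^ (d - r)) * (-1) ^ (d - r) = 1 := by rw [← mul_pow]; simp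
    calc ψ.coeff (d - r) = ∑ s ∈ Finset.range (d + 1), (if s = r then 1 else 0) *
          (ψ.coeff (d - s) * (-1) ^ (d - s) / d.choose s * ((-1) ^ (d - r) * d.choose r)) := by
          rw [Finset.sum_eq_single r]
          · rw [if_pos rfl]; field_simp
            linear_combination (-ψ.coeff (d - r)) * h1
          · intro s _ hs; simp [hs]
          · intro h; exact absurd (Finset.mem_range.2 (by omega)) h
      _ = _ := by
          refine Finset.sum_congr rfl fun s _ => ?_
          rw [← hcoe s, Finset.sum_mul]
          exact Finset.sum_congr rfl fun l _ => by ring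

theorem abs_coeff_prod_C_sub_X_le {ι : Type*} (s : Finset ι) {u : ι → ℝ} {R : ℝ} (hR : 0 ≤ R)
    (hu : ∀ i ∈ s, |u i| ≤ R) (n : ℕ) :
    |(∏ i ∈ s, (C (u i) - X : ℝ[X])).coeff n| ≤ (R + 1) ^ s.card := by
  classical
  induction s using Finset.induction_on generalizing n with
  | empty =>
    simp only [Finset.prod_empty, coeff_one, Finset.card_empty, pow_zero]
    split_ifs <;> simp
  | insert i s hi ih =>
    have ih' := ih fun j hj => hu j (Finset.mem_insert_of_mem hj)
    have hui := hu i (Finset.mem_insert_self _ _)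
    rw [Finset.prod_insert hi, Finset.card_insert_of_notMem hi, sub_mul, coeff_sub, coeff_C_mul,
      pow_succ', add_mul, one_mul]
    refine (abs_sub _ _).trans (add_le_add ?_ ?_)
    · rw [abs_mul]; exact mul_le_mul hui (ih' n) (abs_nonneg _) hR
    · cases n with
      | zero => simp only [coeff_X_mul_zero, abs_zero]; positivity
      | succ n => rw [coeff_X_mul]; exact ih' n

theorem natDegree_prod_C_sub_X_le {ι : Type*} (s : Finset ι) (u : ι → ℝ) :
    (∏ i ∈ s, (C (u i) - X : ℝ[X])).natDegree ≤ s.card := by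
  refine (natDegree_prod_le _ _).trans ?_
  rw [Finset.card_eq_sum_ones]
  refine Finset.sum_le_sum fun i _ => (natDegree_sub_le _ _).trans ?_
  simp

/-- The blossom of a polynomial at points near an interval is bounded by the values of the
polynomial at `d + 1` equally spaced points of the interval. -/
theorem exists_apolar_prod_le (d : ℕ) (R : ℝ) (hR : 0 ≤ R) :
    ∃ K : ℝ, 0 ≤ K ∧ ∀ (a ℓ : ℝ), 0 < ℓ → ∀ u : ℕ → ℝ,
      (∀ i ∈ Finset.range d, |u i - a| ≤ R * ℓ) → ∀ p : ℝ[X], p.degree < (d + 1 : ℕ) →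
      |apolar d p (∏ i ∈ Finset.range d, (C (u i) - X))| ≤
        K * ∑ l ∈ Finset.range (d + 1), |p.eval (a + ℓ * ((l + 1) / (d + 2)))| := by
  set v : ℕ → ℝ := fun l => (l + 1) / (d + 2) with hv
  have hinj : Set.InjOn v (Finset.range (d + 1) : Set ℕ) := by
    intro i _ j _ hij
    simp only [hv] at hij
    rw [div_left_inj' (by positivity)] at hij
    exact_mod_cast add_right_cancel hij
  set B := fun l => Lagrange.basis (Finset.range (d + 1)) v l
  refine ⟨∑ l ∈ Finset.range (d + 1), ∑ r ∈ Finset.range (d + 1), |(B l).coeff r| * (R + 1) ^ d,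
    by positivity, ?_⟩
  intro a ℓ hℓ u hu p hp
  set w : ℕ → ℝ := fun i => (u i - a) / ℓ with hw
  set b : ℕ → ℝ := fun l => apolar d (B l) (∏ i ∈ Finset.range d, (C (w i) - X)) with hb
  have hprod : ∏ i ∈ Finset.range d, (C (u i) - X : ℝ[X]) =
      ∑ l ∈ Finset.range (d + 1), C (b l) * (C (a + ℓ * v l) - X) ^ d := by
    refine Polynomial.funext fun y => ?_
    have h1 := congrArg (fun q : ℝ[X] => ℓ ^ d * q.eval ((y - a) / ℓ)) (eq_sum_apolar_basis_mul
      (by simpa using natDegree_prod_C_sub_X_le (Finset.range d) w) hinj)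
    simp only [eval_finsetSum, eval_mul, eval_C, eval_pow, eval_sub, eval_X, eval_prod,
      Finset.mul_sum] at h1 ⊢
    have h2 : ℓ ^ d * ∏ i ∈ Finset.range d, (w i - (y - a) / ℓ) =
        ∏ i ∈ Finset.range d, (u i - y) := by
      rw [show ℓ ^ d = ∏ _i ∈ Finset.range d, ℓ by simp, ← Finset.prod_mul_distrib]
      refine Finset.prod_congr rfl fun i _ => ?_
      simp only [hw]; field_simp; ring
    rw [← h2, h1]
    refine Finset.sum_congr rfl fun l _ => ?_
    rw [mul_left_comm, ← mul_pow]
    congr 2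
    field_simp; ring
  have hbK : ∀ l ∈ Finset.range (d + 1), |b l| ≤ ∑ l ∈ Finset.range (d + 1),
      ∑ r ∈ Finset.range (d + 1), |(B l).coeff r| * (R + 1) ^ d := by
    intro l hl
    refine le_trans ?_ (Finset.single_le_sum (f := fun l => ∑ r ∈ Finset.range (d + 1),
      |(B l).coeff r| * (R + 1) ^ d) (fun _ _ => by positivity) hl)
    refine (Finset.abs_sum_le_sum_abs _ _).trans (Finset.sum_le_sum fun r hr => ?_)
    rw [abs_mul]
    refine mul_le_mul_of_nonneg_left ?_ (abs_nonneg _)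
    rw [abs_div, abs_mul, abs_pow, abs_neg, abs_one, one_pow, mul_one, Nat.abs_cast]
    have hc : (1 : ℝ) ≤ d.choose r := by
      exact_mod_cast Nat.choose_pos (Nat.lt_succ_iff.1 (Finset.mem_range.1 hr))
    refine (div_le_self (abs_nonneg _) hc).trans ?_
    refine (abs_coeff_prod_C_sub_X_le _ hR (fun i hi => ?_) _).trans_eq (by simp)
    simp only [hw]
    rw [abs_div, abs_of_pos hℓ, div_le_iff₀ hℓ]
    exact hu i hi
  rw [hprod, apolar_sum_right, Finset.mul_sum]
  refine (Finset.abs_sum_le_sum_abs _ _).trans (Finset.sum_le_sum fun l hl => ?_)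
  rw [apolar_C_mul_right, apolar_C_sub_X_pow hp, abs_mul]
  exact mul_le_mul_of_nonneg_right (hbK l hl) (abs_nonneg _)

/-- De Boor's algorithm: the value of a polynomial in a knot interval is an average of its
blossoms at the `d + 1` groups of `d` consecutive knots around that interval. -/
theorem abs_eval_le_of_apolar_le {d j : ℕ} {t : ℕ → ℝ} (ht : Monotone t) (hdj : d ≤ j)
    (htj : t j < t (j + 1)) {x : ℝ} (hx : x ∈ Icc (t j) (t (j + 1))) {p : ℝ[X]}
    (hp : p.degree < (d + 1 : ℕ)) {M : ℝ}
    (hM : ∀ i, i ≤ j → j ≤ i + d →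
      |apolar d p (∏ s ∈ Finset.range d, (C (t (i + 1 + s)) - X))| ≤ M) :
    |p.eval x| ≤ M := by
  have key : ∀ e r, r + e = d → ∀ i, i ≤ j → j ≤ i + r →
      |apolar d p ((∏ s ∈ Finset.range r, (C (t (i + 1 + s)) - X)) * (C x - X) ^ e)| ≤ M := by
    intro e
    induction e with
    | zero =>
      intro r hr i hij hji
      rw [add_zero] at hr
      subst hr
      simpa using hM i hij hji
    | succ e ih =>
      intro r hr i hij hji
      obtain ⟨i, rfl⟩ : ∃ i', i = i' + 1 := ⟨i - 1, by omega⟩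
      have h1 := ih (r + 1) (by omega) i (by omega) (by omega)
      have h2 := ih (r + 1) (by omega) (i + 1) (by omega) (by omega)
      rw [Finset.prod_range_succ'] at h1
      rw [Finset.prod_range_succ] at h2
      set u := t (i + 1)
      set w := t (i + 1 + 1 + r)
      have hux : u ≤ x := (ht hij).trans hx.1
      have hxw : x ≤ w := hx.2.trans (ht (by omega))
      have huw : u < w := ((ht hij).trans_lt htj).trans_le (ht (by omega))
      set ψ : ℝ[X] := ∏ s ∈ Finset.range r, (C (t (i + 1 + 1 + s)) - X) with hψ
      have h1' : |apolar d p (ψ * (C u - X) * (C x - X) ^ e)| ≤ M := by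
        convert h1 using 5
        rw [hψ]
        exact Finset.prod_congr rfl fun s _ => by rw [show i + 1 + 1 + s = i + 1 + (s + 1) by omega]
      set α := (w - x) / (w - u)
      have hα0 : 0 ≤ α := div_nonneg (by linarith) (by linarith)
      have hα1 : α ≤ 1 := (div_le_one (by linarith)).2 (by linarith)
      have hαx : x = α * u + (1 - α) * w := by
        have : w - u ≠ 0 := by linarith
        simp only [α]; field_simp; ring
      have hsplit : ψ * (C x - X) ^ (e + 1) = C α * (ψ * (C u - X) * (C x - X) ^ e) +
          C (1 - α) * (ψ * (C w - X) * (C x - X) ^ e) := by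
        have : (C x - X : ℝ[X]) = C α * (C u - X) + C (1 - α) * (C w - X) := by
          conv_lhs => rw [hαx]
          simp only [map_add, map_mul, map_sub, map_one]; ring
        rw [pow_succ']
        nth_rewrite 1 [this]
        ring
      rw [hsplit, apolar_add_right, apolar_C_mul_right, apolar_C_mul_right]
      refine (abs_add_le _ _).trans ?_
      rw [abs_mul, abs_mul, abs_of_nonneg hα0, abs_of_nonneg (by linarith : 0 ≤ 1 - α)]
      nlinarith
  have := key d 0 (by omega) j le_rfl (by omega)
  simpa [apolar_C_sub_X_pow hp] using this

end Polynomial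

/-! ### Values of splines are controlled on the dominant atoms -/

theorem Polynomial.iteratedDeriv_eval (p : ℝ[X]) (n : ℕ) :
    iteratedDeriv n (fun x => p.eval x) = fun x => (derivative^[n] p).eval x := by
  induction n with
  | zero => simp
  | succ n ih =>
    rw [iteratedDeriv_succ, ih, Function.iterate_succ_apply']
    ext x
    exact Polynomial.deriv _

namespace IntervalPartition

theorem numAtoms_pos (F : IntervalPartition) : 0 < F.numAtoms := by
  rcases Nat.eq_zero_or_pos F.numAtoms with h | h
  · have h0 := F.knot_zero
    have h1 := F.knot_last
    have : (0 : Fin (F.numAtoms + 1)) = Fin.last F.numAtoms := by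
      ext; simp [h]
    rw [this, h1] at h0
    exact absurd h0 one_ne_zero
  · exact h

/-- The knots `0 = gridPoint 0 < ⋯ < gridPoint m = 1`, continued by the value `1`. -/
def gridPoint (F : IntervalPartition) (i : ℕ) : ℝ :=
  F.knot ⟨min i F.numAtoms, by omega⟩

theorem extKnot_eq_gridPoint (F : IntervalPartition) (d i : ℕ) :
    F.extKnot (d + 1) i = F.gridPoint (i - d) := rfl

theorem gridPoint_mono (F : IntervalPartition) : Monotone F.gridPoint := fun i j h =>
  F.strictMono_knot.monotone (by simp only [Fin.mk_le_mk]; omega)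

theorem extKnot_mono (F : IntervalPartition) (d : ℕ) : Monotone (F.extKnot (d + 1)) :=
  fun i j hij => by simp only [extKnot_eq_gridPoint]; exact F.gridPoint_mono (by omega)

theorem gridPoint_lt (F : IntervalPartition) {i j : ℕ} (hij : i < j) (hi : i < F.numAtoms) :
    F.gridPoint i < F.gridPoint j :=
  F.strictMono_knot (by simp only [Fin.mk_lt_mk]; omega)

theorem gridPoint_zero (F : IntervalPartition) : F.gridPoint 0 = 0 := by
  rw [← F.knot_zero]; unfold gridPoint; congr 1

theorem gridPoint_of_le (F : IntervalPartition) {i : ℕ} (hi : F.numAtoms ≤ i) :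
    F.gridPoint i = 1 := by
  rw [← F.knot_last]; unfold gridPoint; congr 1; ext; simp [hi]

theorem gridPoint_mem_Icc (F : IntervalPartition) (i : ℕ) : F.gridPoint i ∈ Icc (0 : ℝ) 1 :=
  ⟨F.gridPoint_zero ▸ F.gridPoint_mono (Nat.zero_le i),
    F.gridPoint_of_le (le_max_right i _) ▸ F.gridPoint_mono (le_max_left i F.numAtoms)⟩

theorem knot_castSucc (F : IntervalPartition) (a : Fin F.numAtoms) :
    F.knot a.castSucc = F.gridPoint a := by
  unfold gridPoint; congr 1; ext; simp [a.2.le]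

theorem knot_succ (F : IntervalPartition) (a : Fin F.numAtoms) :
    F.knot a.succ = F.gridPoint (a + 1) := by
  unfold gridPoint; congr 1; ext; simp

/-- The length of an atom. -/
def width (F : IntervalPartition) (a : Fin F.numAtoms) : ℝ :=
  F.gridPoint (a + 1) - F.gridPoint a

theorem width_pos (F : IntervalPartition) (a : Fin F.numAtoms) : 0 < F.width a :=
  sub_pos.2 (F.gridPoint_lt (Nat.lt_succ_self _) a.2)

theorem Ioo_subset (F : IntervalPartition) (a : Fin F.numAtoms) :
    Ioo (F.gridPoint a) (F.gridPoint (a + 1)) ⊆ F.atom a := by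
  rw [← F.knot_castSucc, ← F.knot_succ]; exact F.Ioo_subset_atom a

theorem atom_subset (F : IntervalPartition) (a : Fin F.numAtoms) :
    F.atom a ⊆ Icc (F.gridPoint a) (F.gridPoint (a + 1)) := by
  rw [← F.knot_castSucc, ← F.knot_succ]; exact F.atom_subset_Icc a

theorem atom_subset_Icc_zero_one (F : IntervalPartition) (a : Fin F.numAtoms) :
    F.atom a ⊆ Icc 0 1 := by
  rw [← F.iUnion_atom]; exact subset_iUnion _ a

/-- The derivatives of order less than `d` of a spline of order `d + 1` extend continuously to the
end points of each atom, and so are given there by the polynomial piece. -/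
theorem iteratedDerivWithin_eq_of_mem_splineSpace (F : IntervalPartition) {d : ℕ} {f : ℝ → ℝ}
    (hf : f ∈ F.splineSpace (d + 1)) {a : Fin F.numAtoms} {p : ℝ[X]}
    (hp : ∀ x ∈ F.atom a, f x = p.eval x) {r : ℕ} (hr : r < d) :
    EqOn (iteratedDerivWithin r f (Icc 0 1)) (fun x => (Polynomial.derivative^[r] p).eval x)
      (Icc (F.gridPoint a) (F.gridPoint (a + 1))) := by
  have hlt := F.gridPoint_lt (Nat.lt_succ_self a) a.2
  have hIcc : Icc (F.gridPoint a) (F.gridPoint (a + 1)) ⊆ Icc 0 1 :=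
    Icc_subset_Icc (F.gridPoint_mem_Icc _).1 (F.gridPoint_mem_Icc _).2
  have hud : UniqueDiffOn ℝ (Icc (0 : ℝ) 1) := uniqueDiffOn_Icc_zero_one
  refine EqOn.of_subset_closure (s := Ioo (F.gridPoint a) (F.gridPoint (a + 1))) ?_ ?_ ?_
    Ioo_subset_Icc_self (by rw [closure_Ioo hlt.ne])
  · intro x hx
    have h1 : f =ᶠ[nhds x] fun x => p.eval x := by
      filter_upwards [Ioo_mem_nhds hx.1 hx.2] with y hy
      exact hp y (F.Ioo_subset a hy)
    rw [Filter.EventuallyEq.iteratedDerivWithin_eq (h1.filter_mono nhdsWithin_le_nhds) h1.eq_of_nhds,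
      iteratedDerivWithin_eq_iteratedDeriv hud ((by simpa using p.contDiff_aeval (𝕜 := ℝ) r : ContDiff ℝ r fun x : ℝ => p.eval x).contDiffAt)
        (hIcc (Ioo_subset_Icc_self hx)), Polynomial.iteratedDeriv_eval]
  · refine ((hf.1 (by omega)).continuousOn_iteratedDerivWithin ?_ hud).mono hIcc
    exact_mod_cast (by omega : r ≤ d + 1 - 2)
  · exact (Polynomial.continuous _).continuousOn

/-- Adjacent polynomial pieces of a spline differ by a multiple of a power at the common knot. -/
theorem exists_sub_eq_C_mul_pow (F : IntervalPartition) {d : ℕ} {f : ℝ → ℝ}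
    (hf : f ∈ F.splineSpace (d + 1)) {p : Fin F.numAtoms → ℝ[X]}
    (hdeg : ∀ a, (p a).degree < (d + 1 : ℕ)) (hp : ∀ a, ∀ x ∈ F.atom a, f x = (p a).eval x)
    {a b : Fin F.numAtoms} (hab : (b : ℕ) = a + 1) :
    ∃ c : ℝ, p b - p a = .C c * (.X - .C (F.gridPoint b)) ^ d := by
  set q := p b - p a with hq
  have hqd : q.degree < (d + 1 : ℕ) := (Polynomial.degree_sub_le _ _).trans_lt
    (max_lt (hdeg b) (hdeg a))
  by_cases h0 : q = 0
  · exact ⟨0, by simp [h0]⟩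
  have hdvd : (.X - .C (F.gridPoint b)) ^ d ∣ q := by
    rcases Nat.eq_zero_or_pos d with rfl | hd
    · simp
    rw [← Polynomial.le_rootMultiplicity_iff h0]
    have : d - 1 < q.rootMultiplicity (F.gridPoint b) := by
      rw [Polynomial.lt_rootMultiplicity_iff_isRoot_iterate_derivative h0]
      intro r hr
      have h1 := F.iteratedDerivWithin_eq_of_mem_splineSpace hf (hp a) (r := r) (by omega)
        (right_mem_Icc.2 (F.gridPoint_mono (Nat.le_succ _)))
      have h2 := F.iteratedDerivWithin_eq_of_mem_splineSpace hf (hp b) (r := r) (by omega)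
        (left_mem_Icc.2 (F.gridPoint_mono (Nat.le_succ _)))
      rw [← hab, h2] at h1
      rw [hq, Polynomial.iterate_derivative_sub, Polynomial.IsRoot.def, Polynomial.eval_sub]
      exact sub_eq_zero.2 h1
    omega
  obtain ⟨r, hr⟩ := hdvd
  have hr0 : r ≠ 0 := by rintro rfl; exact h0 (by simpa using hr)
  have hnd : q.natDegree = d + r.natDegree := by
    rw [hr, Polynomial.natDegree_mul (pow_ne_zero _ (Polynomial.X_sub_C_ne_zero _)) hr0,
      Polynomial.natDegree_pow, Polynomial.natDegree_X_sub_C, mul_one]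
  have : q.natDegree < d + 1 := (Polynomial.natDegree_lt_iff_degree_lt h0).2 hqd
  refine ⟨r.coeff 0, ?_⟩
  rw [← Polynomial.eq_C_of_natDegree_eq_zero (by omega : r.natDegree = 0), mul_comm]
  exact hr

/-- The polynomial `∏ (t - X)` over the `d` interior knots `t` of the `i`-th support. Its apolar
pairing with a polynomial piece of a spline of order `d + 1` is the `i`-th B-spline coefficient. -/
noncomputable def dualPoly (F : IntervalPartition) (d i : ℕ) : ℝ[X] :=
  ∏ s ∈ Finset.range d, (.C (F.extKnot (d + 1) (i + 1 + s)) - .X)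

/-- A B-spline coefficient can be computed from any polynomial piece on the support. -/
theorem apolar_dualPoly_eq (F : IntervalPartition) {d : ℕ} {f : ℝ → ℝ}
    (hf : f ∈ F.splineSpace (d + 1)) {p : Fin F.numAtoms → ℝ[X]}
    (hdeg : ∀ a, (p a).degree < (d + 1 : ℕ)) (hp : ∀ a, ∀ x ∈ F.atom a, f x = (p a).eval x)
    {i : ℕ} {a b : Fin F.numAtoms} (ha : (a : ℕ) ≤ i) (ha' : i ≤ a + d) (hb : (b : ℕ) ≤ i)
    (hb' : i ≤ b + d) :
    Polynomial.apolar d (p a) (F.dualPoly d i) = Polynomial.apolar d (p b) (F.dualPoly d i) := by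
  have key : ∀ n, ∀ a b : Fin F.numAtoms, (b : ℕ) = a + n → i ≤ a + d → (b : ℕ) ≤ i →
      Polynomial.apolar d (p a) (F.dualPoly d i) = Polynomial.apolar d (p b) (F.dualPoly d i) := by
    intro n
    induction n with
    | zero =>
      intro a b hab _ _
      rw [Fin.ext (by simpa using hab) (a := b) (b := a)]
    | succ n ih =>
      intro a b hab ha hb
      have hc : (a : ℕ) + n < F.numAtoms := by have := b.2; omega
      rw [ih a ⟨a + n, hc⟩ rfl ha (by simp; omega)]
      obtain ⟨c, hc'⟩ := F.exists_sub_eq_C_mul_pow hf hdeg hp (a := ⟨a + n, hc⟩) (b := b)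
        (by simp; omega)
      rw [sub_eq_iff_eq_add] at hc'
      have hψ : (F.dualPoly d i).natDegree ≤ d :=
        (Polynomial.natDegree_prod_C_sub_X_le (Finset.range d) _).trans_eq (Finset.card_range d)
      have h0 : (F.dualPoly d i).eval (F.gridPoint b) = 0 := by
        rw [dualPoly, Polynomial.eval_prod]
        refine Finset.prod_eq_zero (i := b + d - (i + 1)) (Finset.mem_range.2 (by omega)) ?_
        rw [extKnot_eq_gridPoint, show i + 1 + (b + d - (i + 1)) - d = b by omega]
        simp
      rw [hc', Polynomial.apolar_add_left, Polynomial.apolar_X_sub_C_pow hψ, h0, mul_zero, zero_add]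
  rcases le_total (a : ℕ) b with h | h
  · exact key (b - a) a b (by omega) ha' hb
  · exact (key (a - b) b a (by omega) hb' ha).symm

/-- An atom is dominant if it is a largest one among the `d + 1` consecutive atoms that make up the
support of some B-spline of order `d + 1` (fewer atoms near the end points). The support with index
`i` consists of the atoms `b` with `i - d ≤ b ≤ i`. -/
def IsDominant (F : IntervalPartition) (d : ℕ) (a : Fin F.numAtoms) : Prop :=
  ∃ i : ℕ, (a : ℕ) ≤ i ∧ i ≤ a + d ∧
    ∀ b : Fin F.numAtoms, (b : ℕ) ≤ i → i ≤ b + d → F.width b ≤ F.width a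

/-- `d + 1` equally spaced points inside an atom. -/
noncomputable def node (F : IntervalPartition) (d : ℕ) (a : Fin F.numAtoms) (l : ℕ) : ℝ :=
  F.gridPoint a + F.width a * ((l + 1) / (d + 2))

theorem node_mem_atom (F : IntervalPartition) {d : ℕ} (a : Fin F.numAtoms) {l : ℕ} (hl : l ≤ d) :
    F.node d a l ∈ F.atom a := by
  refine F.Ioo_subset a ⟨?_, ?_⟩
  · have := F.width_pos a
    have : 0 < F.width a * (((l : ℝ) + 1) / (d + 2)) := by positivity
    unfold node; linarith
  · have h1 : ((l : ℝ) + 1) / (d + 2) < 1 := by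
      rw [div_lt_one (by positivity)]
      have : (l : ℝ) ≤ d := by exact_mod_cast hl
      linarith
    have h2 : F.gridPoint (a + 1) = F.gridPoint a + F.width a := by unfold width; ring
    have := mul_lt_mul_of_pos_left h1 (F.width_pos a)
    unfold node; linarith

/-- If all atoms that make up a support have length at most `ℓ`, the support has length at most
`(d + 1) * ℓ`. -/
theorem gridPoint_sub_le (F : IntervalPartition) {d i : ℕ} {ℓ : ℝ} (hℓ : 0 ≤ ℓ)
    (h : ∀ b : Fin F.numAtoms, (b : ℕ) ≤ i → i ≤ b + d → F.width b ≤ ℓ) :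
    F.gridPoint (i + 1) - F.gridPoint (i - d) ≤ (d + 1) * ℓ := by
  have key : ∀ e, i - d + e ≤ i + 1 →
      F.gridPoint (i - d + e) - F.gridPoint (i - d) ≤ e * ℓ := by
    intro e
    induction e with
    | zero => intro _; simp
    | succ e ih =>
      intro he
      have h1 := ih (by omega)
      have h2 : F.gridPoint (i - d + (e + 1)) - F.gridPoint (i - d + e) ≤ ℓ := by
        by_cases hm : i - d + e < F.numAtoms
        · exact h ⟨i - d + e, hm⟩ (by simp; omega) (by simp; omega)
        · rw [F.gridPoint_of_le (by omega), F.gridPoint_of_le (by omega)]; simpa using hℓ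
      push_cast; linarith
  have h1 := key (i + 1 - (i - d)) (by omega)
  rw [show i - d + (i + 1 - (i - d)) = i + 1 by omega] at h1
  refine h1.trans (mul_le_mul_of_nonneg_right ?_ hℓ)
  exact_mod_cast (by omega : i + 1 - (i - d) ≤ d + 1)

open Classical in
/-- The dominant atoms at distance at most `d` from the atom `a`. -/
noncomputable def dominantNear (F : IntervalPartition) (d : ℕ) (a : Fin F.numAtoms) :
    Finset (Fin F.numAtoms) :=
  {b | F.IsDominant d b ∧ (b : ℕ) ≤ a + d ∧ (a : ℕ) ≤ b + d}

theorem mem_dominantNear (F : IntervalPartition) {d : ℕ} {a b : Fin F.numAtoms} :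
    b ∈ F.dominantNear d a ↔ F.IsDominant d b ∧ (b : ℕ) ≤ a + d ∧ (a : ℕ) ≤ b + d := by
  simp [dominantNear]

theorem card_dominantNear_le (F : IntervalPartition) (d : ℕ) (a : Fin F.numAtoms) :
    (F.dominantNear d a).card ≤ 2 * d + 1 := by
  rw [← Finset.card_map Fin.valEmbedding]
  refine (Finset.card_le_card (t := Finset.Icc (a - d : ℕ) (a + d)) fun n hn => ?_).trans ?_
  · obtain ⟨b, hb, rfl⟩ := Finset.mem_map.1 hn
    have := F.mem_dominantNear.1 hb
    rw [Finset.mem_Icc, Fin.valEmbedding_apply]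
    omega
  · rw [Nat.card_Icc]; omega

/-- Stability of the B-spline basis, in a form that does not mention the basis: the values of a
spline are controlled by its values at the nodes of the dominant atoms nearby, uniformly in the
partition. -/
theorem exists_sq_le_sum_node (d : ℕ) : ∃ K : ℝ, 0 ≤ K ∧ ∀ (F : IntervalPartition) (f : ℝ → ℝ),
    f ∈ F.splineSpace (d + 1) → ∀ (a : Fin F.numAtoms), ∀ x ∈ F.atom a,
      f x ^ 2 ≤ K * ∑ b ∈ F.dominantNear d a, ∑ l ∈ Finset.range (d + 1), f (F.node d b l) ^ 2 := by
  obtain ⟨K, hK0, hK⟩ := Polynomial.exists_apolar_prod_le d (d + 1) (by positivity)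
  refine ⟨(K * (d + 1)) ^ 2, by positivity, fun F f hf a x hx => ?_⟩
  choose p hdeg hp using hf.2
  set Q := ∑ b ∈ F.dominantNear d a, ∑ l ∈ Finset.range (d + 1), f (F.node d b l) ^ 2
  have hQ : 0 ≤ Q := by positivity
  suffices H : |f x| ≤ K * (d + 1) * √Q by
    calc f x ^ 2 = |f x| ^ 2 := (sq_abs _).symm
      _ ≤ (K * (d + 1) * √Q) ^ 2 := by gcongr
      _ = _ := by rw [mul_pow, Real.sq_sqrt hQ]
  rw [hp a x hx]
  have e1 : F.extKnot (d + 1) (a + d) = F.gridPoint a := by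
    rw [extKnot_eq_gridPoint]; congr 1; omega
  have e2 : F.extKnot (d + 1) (a + d + 1) = F.gridPoint (a + 1) := by
    rw [extKnot_eq_gridPoint]; congr 1; omega
  refine Polynomial.abs_eval_le_of_apolar_le (d := d) (j := a + d) (F.extKnot_mono d) (by omega)
    (by rw [e1, e2]; exact F.gridPoint_lt (Nat.lt_succ_self _) a.2)
    (by rw [e1, e2]; exact F.atom_subset a hx) (hdeg a) ?_
  intro i hi1 hi2
  have hne : (Finset.univ.filter fun b : Fin F.numAtoms => (b : ℕ) ≤ i ∧ i ≤ b + d).Nonempty :=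
    ⟨a, by simp only [Finset.mem_filter, Finset.mem_univ, true_and]; omega⟩
  obtain ⟨b, hb, hbmax⟩ := Finset.exists_max_image _ F.width hne
  simp only [Finset.mem_filter, Finset.mem_univ, true_and] at hb hbmax
  have hdom : F.IsDominant d b := ⟨i, hb.1, hb.2, fun c h1 h2 => hbmax c ⟨h1, h2⟩⟩
  have hbn : b ∈ F.dominantNear d a := F.mem_dominantNear.2 ⟨hdom, by omega, by omega⟩
  have hlen := F.gridPoint_sub_le (i := i) (d := d) (F.width_pos b).le
    fun c h1 h2 => hbmax c ⟨h1, h2⟩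
  change |Polynomial.apolar d (p a) (F.dualPoly d i)| ≤ _
  rw [F.apolar_dualPoly_eq hf hdeg hp (a := a) (b := b) (by omega) (by omega) hb.1 hb.2]
  refine (hK (F.gridPoint b) (F.width b) (F.width_pos b)
    (fun s => F.extKnot (d + 1) (i + 1 + s)) ?_ (p b) (hdeg b)).trans ?_
  · intro s hs
    have hs' := Finset.mem_range.1 hs
    simp only [extKnot_eq_gridPoint]
    have h1 : F.gridPoint (i - d) ≤ F.gridPoint b := F.gridPoint_mono (by omega)
    have h2 : F.gridPoint b ≤ F.gridPoint (i + 1) := F.gridPoint_mono (by omega)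
    have h3 : F.gridPoint (i - d) ≤ F.gridPoint (i + 1 + s - d) := F.gridPoint_mono (by omega)
    have h4 : F.gridPoint (i + 1 + s - d) ≤ F.gridPoint (i + 1) := F.gridPoint_mono (by omega)
    rw [abs_le]; constructor <;> linarith
  · rw [mul_assoc]
    refine mul_le_mul_of_nonneg_left ?_ hK0
    have : ∀ l ∈ Finset.range (d + 1),
        |(p b).eval (F.gridPoint b + F.width b * ((l + 1) / (d + 2)))| ≤ √Q := by
      intro l hl
      have hn := hp b _ (F.node_mem_atom b (Nat.lt_succ_iff.1 (Finset.mem_range.1 hl)))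
      unfold node at hn
      rw [← hn]
      refine Real.abs_le_sqrt ?_
      refine (Finset.single_le_sum (f := fun l => f (F.node d b l) ^ 2)
        (fun _ _ => sq_nonneg _) hl).trans ?_
      exact Finset.single_le_sum (f := fun b => ∑ l ∈ Finset.range (d + 1), f (F.node d b l) ^ 2)
        (fun _ _ => by positivity) hbn
    refine (Finset.sum_le_sum this).trans_eq ?_
    simp

end IntervalPartition

/-! ### Spline bumps around an atom -/

theorem Polynomial.exists_derivative_eq {d : ℕ} {p : ℝ[X]} (hp : p.degree < (d + 1 : ℕ)) :
    ∃ P : ℝ[X], P.degree < (d + 2 : ℕ) ∧ derivative P = p := by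
  have hnd : p.natDegree < d + 1 :=
    Nat.lt_succ_iff.2 (natDegree_le_of_degree_le (Order.lt_succ_iff.1 hp))
  refine ⟨∑ i ∈ Finset.range (d + 1), C (p.coeff i / (i + 1)) * X ^ (i + 1), ?_, ?_⟩
  · refine (degree_sum_le _ _).trans_lt ((Finset.sup_lt_iff (WithBot.bot_lt_coe _)).2 fun i hi => ?_)
    refine (degree_C_mul_X_pow_le _ _).trans_lt ?_
    exact_mod_cast (by have := Finset.mem_range.1 hi; omega : i + 1 < d + 2)
  · conv_rhs => rw [as_sum_range_C_mul_X_pow' p hnd]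
    rw [derivative_sum]
    refine Finset.sum_congr rfl fun i _ => ?_
    rw [derivative_C_mul_X_pow]
    congr 2
    push_cast
    field_simp

namespace IntervalPartition

theorem exists_mem_atom (F : IntervalPartition) {x : ℝ} (hx : x ∈ Icc (0 : ℝ) 1) :
    ∃ a, x ∈ F.atom a := by
  rw [← F.iUnion_atom] at hx; exact mem_iUnion.1 hx

theorem eq_of_mem_atom (F : IntervalPartition) {a b : Fin F.numAtoms} {x : ℝ} (ha : x ∈ F.atom a)
    (hb : x ∈ F.atom b) : a = b := by
  by_contra h
  exact (F.disjoint_atom h).le_bot ⟨ha, hb⟩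

theorem le_of_mem_atom_of_le (F : IntervalPartition) {a b : Fin F.numAtoms} {x y : ℝ}
    (hx : x ∈ F.atom a) (hy : y ∈ F.atom b) (hxy : x ≤ y) : a ≤ b := by
  by_contra! h
  have h1 := (F.atom_subset a hx).1
  have h2 := (F.atom_subset b hy).2
  have h3 : F.gridPoint (b + 1) ≤ F.gridPoint a := F.gridPoint_mono h
  have : x = y := by linarith
  subst this
  exact absurd (F.eq_of_mem_atom hx hy) h.ne'

theorem measurable_and_bounded_representative (F : IntervalPartition) {k : ℕ} {f : ℝ → ℝ}
    (hf : f ∈ F.splineSpace k) : ∃ t ∈ F.splineSpace k, EqOn f t (Icc 0 1) ∧ Measurable t ∧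
      ∃ C, ∀ x, ‖t x‖ ≤ C := by
  obtain ⟨t, ⟨⟨q, rfl⟩, ht⟩, he⟩ := F.exists_piecewisePoly hf
  exact ⟨_, ht, he, F.measurable_piecewisePoly q, F.bounded_piecewisePoly q⟩

theorem integrableOn_of_mem_splineSpace (F : IntervalPartition) {k : ℕ} {f : ℝ → ℝ}
    (hf : f ∈ F.splineSpace k) : IntegrableOn f (Icc 0 1) := by
  obtain ⟨t, -, he, hm, C, hC⟩ := F.measurable_and_bounded_representative hf
  refine IntegrableOn.congr_fun ?_ he.symm measurableSet_Icc
  exact Measure.integrableOn_of_bounded (by simp) hm.aestronglyMeasurable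
    (Filter.Eventually.of_forall hC)

theorem const_mem_splineSpace (F : IntervalPartition) (d : ℕ) (c : ℝ) :
    (fun _ => c) ∈ F.splineSpace (d + 1) :=
  ⟨fun _ => contDiffOn_const, fun _ => ⟨.C c, Polynomial.degree_C_le.trans_lt
    (by exact_mod_cast Nat.succ_pos d), fun _ _ => by simp⟩⟩

theorem intervalIntegrable_of_mem_splineSpace (F : IntervalPartition) {k : ℕ} {f : ℝ → ℝ}
    (hf : f ∈ F.splineSpace k) {x y : ℝ} (hx : x ∈ Icc (0 : ℝ) 1) (hy : y ∈ Icc (0 : ℝ) 1) :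
    IntervalIntegrable f volume x y :=
  ((F.integrableOn_of_mem_splineSpace hf).mono_set (uIcc_subset_Icc hx hy)).intervalIntegrable

/-- Integration raises the order of a spline by one. -/
theorem primitive_mem_splineSpace (F : IntervalPartition) {d : ℕ} {f : ℝ → ℝ}
    (hf : f ∈ F.splineSpace (d + 1)) :
    (fun x => ∫ y in (0 : ℝ)..x, f y) ∈ F.splineSpace (d + 2) := by
  have h0 : (0 : ℝ) ∈ Icc (0 : ℝ) 1 := by simp
  refine ⟨fun _ => ?_, fun a => ?_⟩
  · rcases d with - | e
    · have : ContinuousOn (fun x => ∫ y in (0 : ℝ)..x, f y) (uIcc 0 1) :=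
        intervalIntegral.continuousOn_primitive_interval
          (by rw [uIcc_of_le zero_le_one]; exact F.integrableOn_of_mem_splineSpace hf)
      rw [uIcc_of_le zero_le_one] at this
      exact contDiffOn_zero.2 this
    · have hfc : ContDiffOn ℝ e f (Icc 0 1) := hf.1 (by omega)
      set g : ℝ → ℝ := IccExtend zero_le_one ((Icc (0 : ℝ) 1).domRestrict f) with hg
      have hgc : Continuous g := (continuousOn_iff_continuous_domRestrict.1 hfc.continuousOn).Icc_extend'
      have hgf : EqOn g f (Icc 0 1) := fun x hx => by
        rw [hg, IccExtend_of_mem _ _ hx]; rfl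
      have hder : ∀ x ∈ Icc (0 : ℝ) 1,
          HasDerivWithinAt (fun x => ∫ y in (0 : ℝ)..x, f y) (f x) (Icc 0 1) x := by
        intro x hx
        have h1 := (hgc.integral_hasStrictDerivAt 0 x).hasDerivAt.hasDerivWithinAt (s := Icc 0 1)
        rw [hgf hx] at h1
        have h2 : ∀ z ∈ Icc (0 : ℝ) 1, ∫ y in (0 : ℝ)..z, f y = ∫ y in (0 : ℝ)..z, g y :=
          fun z hz => intervalIntegral.integral_congr fun y hy =>
            (hgf (uIcc_subset_Icc h0 hz hy)).symm
        exact h1.congr h2 (h2 x hx)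
      have : ContDiffOn ℝ (e + 1 : WithTop ℕ∞) (fun x => ∫ y in (0 : ℝ)..x, f y) (Icc 0 1) := by
        rw [contDiffOn_succ_iff_derivWithin uniqueDiffOn_Icc_zero_one]
        refine ⟨fun x hx => (hder x hx).differentiableWithinAt, by simp, hfc.congr fun x hx => ?_⟩
        exact (hder x hx).derivWithin (uniqueDiffOn_Icc_zero_one x hx)
      exact_mod_cast this
  · obtain ⟨p, hp, hpf⟩ := hf.2 a
    obtain ⟨P, hP, hPp⟩ := Polynomial.exists_derivative_eq hp
    set κ := F.gridPoint a
    have hκ : κ ∈ Icc (0 : ℝ) 1 := F.gridPoint_mem_Icc a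
    refine ⟨P + .C ((∫ y in (0 : ℝ)..κ, f y) - P.eval κ), ?_, fun x hx => ?_⟩
    · exact (Polynomial.degree_add_le _ _).trans_lt (max_lt hP (Polynomial.degree_C_le.trans_lt
        (by exact_mod_cast Nat.succ_pos _)))
    · have hx1 := F.atom_subset_Icc_zero_one a hx
      have hxa := F.atom_subset a hx
      have h1 : ∫ y in κ..x, f y = P.eval x - P.eval κ := by
        rw [intervalIntegral.integral_congr_Ioo_of_le (g := fun y => p.eval y) hxa.1
          (fun y hy => hpf y (F.Ioo_subset a ⟨hy.1, hy.2.trans_le hxa.2⟩))]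
        refine intervalIntegral.integral_eq_sub_of_hasDerivAt
          (f := fun y => P.eval y) (fun y _ => ?_)
          (p.continuous.intervalIntegrable _ _)
        rw [← hPp]; exact P.hasDerivAt y
      have h2 := intervalIntegral.integral_add_adjacent_intervals
        (F.intervalIntegrable_of_mem_splineSpace hf h0 hκ)
        (F.intervalIntegrable_of_mem_splineSpace hf hκ hx1)
      simp only [Polynomial.eval_add, Polynomial.eval_C]
      linarith

/-- There are splines that increase from `0` to `1` across a fixed number of atoms. They are
obtained by repeatedly integrating the difference of two of them. -/
theorem exists_step_mem_splineSpace (d : ℕ) : ∃ W : ℕ, ∀ (F : IntervalPartition) (p : ℕ),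
    ∃ s ∈ F.splineSpace (d + 1), (∀ x ∈ Icc (0 : ℝ) 1, s x ∈ Icc (0 : ℝ) 1) ∧
      (∀ a : Fin F.numAtoms, (a : ℕ) < p → ∀ x ∈ F.atom a, s x = 0) ∧
      (∀ a : Fin F.numAtoms, p + W ≤ a → ∀ x ∈ F.atom a, s x = 1) := by
  induction d with
  | zero =>
    refine ⟨0, fun F p => ?_⟩
    classical
    have hs0 : ∀ a : Fin F.numAtoms, (a : ℕ) < p → ∀ x ∈ F.atom a,
        (if ∃ b : Fin F.numAtoms, p ≤ b ∧ x ∈ F.atom b then (1 : ℝ) else 0) = 0 := by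
      intro a ha x hx
      rw [if_neg]
      rintro ⟨b, hb, hxb⟩
      rw [F.eq_of_mem_atom hx hxb] at ha
      omega
    have hs1 : ∀ a : Fin F.numAtoms, p + 0 ≤ a → ∀ x ∈ F.atom a,
        (if ∃ b : Fin F.numAtoms, p ≤ b ∧ x ∈ F.atom b then (1 : ℝ) else 0) = 1 :=
      fun a ha x hx => if_pos ⟨a, ha, hx⟩
    refine ⟨_, ⟨by omega, fun a => ?_⟩, fun x _ => ?_, hs0, hs1⟩
    · rcases lt_or_ge (a : ℕ) p with h | h
      · exact ⟨0, by simp, fun x hx => by rw [hs0 a h x hx]; simp⟩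
      · exact ⟨1, by simp, fun x hx => by rw [hs1 a h x hx]; simp⟩
    · split_ifs <;> simp
  | succ d ih =>
    obtain ⟨W, hW⟩ := ih
    refine ⟨2 * W + 1, fun F p => ?_⟩
    by_cases hm : F.numAtoms ≤ p + W
    · refine ⟨0, Submodule.zero_mem _, by simp, by simp, fun a ha => ?_⟩
      have := a.2
      omega
    push Not at hm
    obtain ⟨s₁, hs₁, hI₁, hz₁, ho₁⟩ := hW F p
    obtain ⟨s₂, hs₂, hI₂, hz₂, ho₂⟩ := hW F (p + W + 1)
    set ψ : ℝ → ℝ := s₁ - s₂ with hψ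
    have hψS : ψ ∈ F.splineSpace (d + 1) := Submodule.sub_mem _ hs₁ hs₂
    have hψ0 : ∀ x ∈ Icc (0 : ℝ) 1, 0 ≤ ψ x := by
      intro x hx
      obtain ⟨a, ha⟩ := F.exists_mem_atom hx
      simp only [hψ, Pi.sub_apply]
      rcases lt_or_ge (a : ℕ) (p + W + 1) with h | h
      · rw [hz₂ a h x ha]; linarith [(hI₁ x hx).1]
      · rw [ho₁ a (by omega) x ha]; linarith [(hI₂ x hx).2]
    have hint : ∀ {x y : ℝ}, x ∈ Icc (0 : ℝ) 1 → y ∈ Icc (0 : ℝ) 1 →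
        IntervalIntegrable ψ volume x y := F.intervalIntegrable_of_mem_splineSpace hψS
    have h00 : (0 : ℝ) ∈ Icc (0 : ℝ) 1 := by simp
    have h11 : (1 : ℝ) ∈ Icc (0 : ℝ) 1 := by simp
    have hnn : ∀ {x y : ℝ}, x ∈ Icc (0 : ℝ) 1 → y ∈ Icc (0 : ℝ) 1 → x ≤ y →
        0 ≤ ∫ z in x..y, ψ z := fun hx hy hxy =>
      intervalIntegral.integral_nonneg hxy fun z hz => hψ0 z ⟨hx.1.trans hz.1, hz.2.trans hy.2⟩
    have hadd : ∀ {x y z : ℝ}, x ∈ Icc (0 : ℝ) 1 → y ∈ Icc (0 : ℝ) 1 → z ∈ Icc (0 : ℝ) 1 →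
        (∫ w in x..y, ψ w) + ∫ w in y..z, ψ w = ∫ w in x..z, ψ w := fun hx hy hz =>
      intervalIntegral.integral_add_adjacent_intervals (hint hx hy) (hint hy hz)
    -- The difference equals `1` on the atom with index `p + W`, so its integral is positive.
    have hpos : 0 < ∫ x in (0 : ℝ)..1, ψ x := by
      set b : Fin F.numAtoms := ⟨p + W, hm⟩
      have hb := F.gridPoint_mem_Icc b
      have hb' := F.gridPoint_mem_Icc (b + 1)
      have h1 : ∫ x in F.gridPoint b..F.gridPoint (b + 1), ψ x = F.width b := by
        rw [intervalIntegral.integral_congr_Ioo_of_le (g := fun _ => (1 : ℝ))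
          (F.gridPoint_mono (Nat.le_succ _))]
        · simp [width]
        · intro x hx
          have hx' := F.Ioo_subset b hx
          simp only [hψ, Pi.sub_apply]
          rw [ho₁ b le_rfl x hx', hz₂ b (Nat.lt_succ_self _) x hx', sub_zero]
      rw [← hadd h00 hb' h11, ← hadd h00 hb hb', h1]
      have := F.width_pos b
      have := hnn h00 hb hb.1
      have := hnn hb' h11 hb'.2
      linarith
    set I := ∫ x in (0 : ℝ)..1, ψ x
    refine ⟨I⁻¹ • fun x => ∫ y in (0 : ℝ)..x, ψ y,
      Submodule.smul_mem _ _ (F.primitive_mem_splineSpace hψS), fun x hx => ?_,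
      fun a ha x hx => ?_, fun a ha x hx => ?_⟩
    · simp only [Pi.smul_apply, smul_eq_mul]
      refine ⟨mul_nonneg (inv_nonneg.2 hpos.le) (hnn h00 hx hx.1), ?_⟩
      rw [inv_mul_le_iff₀ hpos, mul_one, ← add_zero (∫ y in (0 : ℝ)..x, ψ y)]
      change _ ≤ ∫ x in (0 : ℝ)..1, ψ x
      rw [← hadd h00 hx h11]
      linarith [hnn hx h11 hx.2]
    · have hx1 := F.atom_subset_Icc_zero_one a hx
      have : ∫ y in (0 : ℝ)..x, ψ y = 0 := by
        rw [intervalIntegral.integral_congr (g := fun _ => (0 : ℝ))]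
        · simp
        · intro y hy
          have hy1 := uIcc_subset_Icc h00 hx1 hy
          rw [uIcc_of_le hx1.1] at hy
          obtain ⟨b, hb⟩ := F.exists_mem_atom hy1
          have hba : (b : ℕ) ≤ a := F.le_of_mem_atom_of_le hb hx hy.2
          simp only [hψ, Pi.sub_apply]
          rw [hz₁ b (by omega) y hb, hz₂ b (by omega) y hb, sub_zero]
      simp [this]
    · have hx1 := F.atom_subset_Icc_zero_one a hx
      have : ∫ y in x..1, ψ y = 0 := by
        rw [intervalIntegral.integral_congr (g := fun _ => (0 : ℝ))]
        · simp
        · intro y hy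
          have hy1 := uIcc_subset_Icc hx1 h11 hy
          rw [uIcc_of_le hx1.2] at hy
          obtain ⟨b, hb⟩ := F.exists_mem_atom hy1
          have hab : (a : ℕ) ≤ b := F.le_of_mem_atom_of_le hx hb hy.1
          simp only [hψ, Pi.sub_apply]
          rw [ho₁ b (by omega) y hb, ho₂ b (by omega) y hb, sub_self]
      have h1 := hadd h00 hx1 h11
      rw [this, add_zero] at h1
      simp only [Pi.smul_apply, smul_eq_mul, h1]
      exact inv_mul_cancel₀ hpos.ne'

/-- There are nonnegative splines that equal `1` near a given atom and vanish outside a fixed number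
of atoms around it. -/
theorem exists_bump_mem_splineSpace (d : ℕ) : ∃ R : ℕ, ∀ (F : IntervalPartition)
    (a : Fin F.numAtoms), ∃ φ ∈ F.splineSpace (d + 1), (∀ x ∈ Icc (0 : ℝ) 1, 0 ≤ φ x) ∧
      (∀ b : Fin F.numAtoms, (a : ℕ) ≤ b + d → (b : ℕ) ≤ a + d → ∀ x ∈ F.atom b, φ x = 1) ∧
      ∫ x in Icc (0 : ℝ) 1, φ x ≤ F.gridPoint (a + R + 1) - F.gridPoint (a - R) := by
  obtain ⟨W, hW⟩ := exists_step_mem_splineSpace d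
  refine ⟨d + W, fun F a => ?_⟩
  -- The left step, which is the constant `1` if there is no room for it.
  obtain ⟨s₁, hs₁, hI₁, hz₁, ho₁⟩ : ∃ s ∈ F.splineSpace (d + 1),
      (∀ x ∈ Icc (0 : ℝ) 1, s x ∈ Icc (0 : ℝ) 1) ∧
      (∀ b : Fin F.numAtoms, (b : ℕ) + d + W < a → ∀ x ∈ F.atom b, s x = 0) ∧
      (∀ b : Fin F.numAtoms, (a : ℕ) ≤ b + d → ∀ x ∈ F.atom b, s x = 1) := by
    by_cases h : d + W ≤ a
    · obtain ⟨s, hs, hI, hz, ho⟩ := hW F (a - (d + W))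
      exact ⟨s, hs, hI, fun b hb => hz b (by omega), fun b hb => ho b (by omega)⟩
    · exact ⟨_, F.const_mem_splineSpace d 1, by simp, fun b hb => by omega, by simp⟩
  obtain ⟨s₂, hs₂, hI₂, hz₂, ho₂⟩ := hW F (a + d + 1)
  have hφ0 : ∀ x ∈ Icc (0 : ℝ) 1, 0 ≤ (s₁ - s₂) x := by
    intro x hx
    obtain ⟨b, hb⟩ := F.exists_mem_atom hx
    simp only [Pi.sub_apply]
    rcases lt_or_ge (b : ℕ) (a + d + 1) with h | h
    · rw [hz₂ b h x hb]; linarith [(hI₁ x hx).1]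
    · rw [ho₁ b (by omega) x hb]; linarith [(hI₂ x hx).2]
  refine ⟨s₁ - s₂, Submodule.sub_mem _ hs₁ hs₂, hφ0, fun b hab hba x hx => ?_, ?_⟩
  · simp only [Pi.sub_apply]
    rw [ho₁ b hab x hx, hz₂ b (by omega) x hx, sub_zero]
  · set J := Icc (F.gridPoint (a - (d + W))) (F.gridPoint (a + (d + W) + 1))
    have hJ : J ⊆ Icc 0 1 := Icc_subset_Icc (F.gridPoint_mem_Icc _).1 (F.gridPoint_mem_Icc _).2
    have hle : ∀ x ∈ Icc (0 : ℝ) 1, (s₁ - s₂) x ≤ J.indicator 1 x := by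
      intro x hx
      obtain ⟨b, hb⟩ := F.exists_mem_atom hx
      have hxb := F.atom_subset b hb
      simp only [Pi.sub_apply]
      by_cases h1 : (b : ℕ) + d + W < a
      · rw [hz₁ b h1 x hb]
        exact le_trans (by linarith [(hI₂ x hx).1]) (indicator_nonneg (by simp) _)
      by_cases h2 : a + d + 1 + W ≤ b
      · rw [ho₂ b h2 x hb]
        exact le_trans (by linarith [(hI₁ x hx).2]) (indicator_nonneg (by simp) _)
      · have hxJ : x ∈ J := ⟨(F.gridPoint_mono (by omega)).trans hxb.1,
          hxb.2.trans (F.gridPoint_mono (by omega))⟩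
        rw [indicator_of_mem hxJ]
        have := (hI₁ x hx).2
        have := (hI₂ x hx).1
        simp only [Pi.one_apply]; linarith
    calc ∫ x in Icc (0 : ℝ) 1, (s₁ - s₂) x ≤ ∫ x in Icc (0 : ℝ) 1, J.indicator 1 x := by
          refine setIntegral_mono_on
            (F.integrableOn_of_mem_splineSpace (Submodule.sub_mem _ hs₁ hs₂)) ?_
            measurableSet_Icc hle
          exact (integrable_indicator_iff measurableSet_Icc).2 (integrableOn_const (by
            rw [Measure.restrict_apply measurableSet_Icc]
            exact ((measure_mono inter_subset_left).trans_lt measure_Icc_lt_top).ne))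
      _ = volume.real J := by
          rw [integral_indicator_one measurableSet_Icc, measureReal_restrict_apply measurableSet_Icc,
            inter_eq_left.2 hJ]
      _ = _ := by
          rw [Real.volume_real_Icc_of_le (F.gridPoint_mono (by omega))]

end IntervalPartition

/-! ### The regularity parameter and lengths of atoms -/

namespace IntervalPartition

theorem mem_Icc_of_bsplineAux_ne_zero (F : IntervalPartition) (d r i : ℕ) (x : ℝ)
    (h : F.bsplineAux (d + 1) r i x ≠ 0) :
    x ∈ Icc (F.extKnot (d + 1) i) (F.extKnot (d + 1) (i + r + 1)) := by
  induction r generalizing i with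
  | zero =>
    simp only [bsplineAux, Nat.add_sub_cancel] at h
    split_ifs at h with hi
    · have hx := F.atom_subset _ (mem_of_indicator_ne_zero h)
      simp only [extKnot_eq_gridPoint]
      rwa [show i + 0 + 1 - d = i - d + 1 by omega]
    · exact absurd rfl h
  | succ r ih =>
    rw [bsplineAux] at h
    by_cases h1 : F.bsplineAux (d + 1) r i x = 0
    · have h2 : F.bsplineAux (d + 1) r (i + 1) x ≠ 0 := fun h2 => by simp [h1, h2] at h
      have := ih (i + 1) h2
      refine ⟨(F.extKnot_mono d (Nat.le_succ i)).trans this.1, this.2.trans_eq ?_⟩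
      congr 1; omega
    · exact ⟨(ih i h1).1, (ih i h1).2.trans (F.extKnot_mono d (by omega))⟩

theorem bsplineAux_summands_nonneg (F : IntervalPartition) (d r i : ℕ) (x : ℝ)
    (h0 : ∀ i, 0 ≤ F.bsplineAux (d + 1) r i x) :
    0 ≤ (x - F.extKnot (d + 1) i) / (F.extKnot (d + 1) (i + r + 1) - F.extKnot (d + 1) i) *
        F.bsplineAux (d + 1) r i x ∧
    0 ≤ (F.extKnot (d + 1) (i + r + 2) - x) /
        (F.extKnot (d + 1) (i + r + 2) - F.extKnot (d + 1) (i + 1)) *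
        F.bsplineAux (d + 1) r (i + 1) x := by
  constructor
  · by_cases h : F.bsplineAux (d + 1) r i x = 0
    · simp [h]
    · have := F.mem_Icc_of_bsplineAux_ne_zero d r i x h
      exact mul_nonneg (div_nonneg (sub_nonneg.2 this.1)
        (sub_nonneg.2 (F.extKnot_mono d (by omega)))) (h0 i)
  · by_cases h : F.bsplineAux (d + 1) r (i + 1) x = 0
    · simp [h]
    · have := F.mem_Icc_of_bsplineAux_ne_zero d r (i + 1) x h
      rw [show i + 1 + r + 1 = i + r + 2 by omega] at this
      exact mul_nonneg (div_nonneg (sub_nonneg.2 this.2)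
        (sub_nonneg.2 (F.extKnot_mono d (by omega)))) (h0 _)

theorem bsplineAux_nonneg (F : IntervalPartition) (d r i : ℕ) (x : ℝ) :
    0 ≤ F.bsplineAux (d + 1) r i x := by
  induction r generalizing i with
  | zero =>
    rw [bsplineAux]
    split_ifs
    · exact indicator_nonneg (by simp) _
    · exact le_rfl
  | succ r ih =>
    rw [bsplineAux]
    exact add_nonneg (F.bsplineAux_summands_nonneg d r i x ih).1
      (F.bsplineAux_summands_nonneg d r i x ih).2

theorem bsplineAux_pos (F : IntervalPartition) (d r i : ℕ) {x : ℝ} (hx : x ∉ range F.gridPoint)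
    (h1 : F.extKnot (d + 1) i < x) (h2 : x < F.extKnot (d + 1) (i + r + 1)) :
    0 < F.bsplineAux (d + 1) r i x := by
  induction r generalizing i with
  | zero =>
    simp only [extKnot_eq_gridPoint] at h1 h2
    have hd : d ≤ i := by
      by_contra! h
      rw [show i - d = i + 0 + 1 - d by omega] at h1
      exact lt_asymm h1 h2
    have hm : i - d < F.numAtoms := by
      by_contra! h
      rw [F.gridPoint_of_le h] at h1
      rw [F.gridPoint_of_le (by omega)] at h2
      exact lt_asymm h1 h2
    rw [show i + 0 + 1 - d = i - d + 1 by omega] at h2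
    have hmem : x ∈ F.atom ⟨i - d, hm⟩ := F.Ioo_subset ⟨i - d, hm⟩ ⟨h1, h2⟩
    simp only [bsplineAux, Nat.add_sub_cancel]
    rw [dif_pos ⟨hd, hm⟩, indicator_of_mem hmem]
    exact one_pos
  | succ r ih =>
    have hnn := F.bsplineAux_summands_nonneg d r i x (fun i => F.bsplineAux_nonneg d r i x)
    rw [bsplineAux]
    have hne : x ≠ F.extKnot (d + 1) (i + r + 1) := fun h => hx ⟨i + r + 1 - d, h.symm⟩
    rcases lt_or_gt_of_ne hne with h | h
    · refine add_pos_of_pos_of_nonneg (mul_pos (div_pos ?_ ?_) (ih i h1 h)) hnn.2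
      · linarith
      · linarith
    · have h3 : F.extKnot (d + 1) (i + 1) < x := (F.extKnot_mono d (by omega)).trans_lt h
      refine add_pos_of_nonneg_of_pos hnn.1 (mul_pos (div_pos ?_ ?_) (ih (i + 1) h3 ?_))
      · exact sub_pos.2 h2
      · exact sub_pos.2 (h3.trans h2)
      · rwa [show i + 1 + r + 1 = i + (r + 1) + 1 by omega]

/-- The support of the `i`-th B-spline of order `d + 1` consists of the atoms `b` with
`i - d ≤ b ≤ i`. -/
theorem volume_bsplineSupport (F : IntervalPartition) (d i : ℕ) :
    volume (F.bsplineSupport (d + 1) i) =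
      ENNReal.ofReal (F.gridPoint (i + 1) - F.gridPoint (i - d)) := by
  have e : F.extKnot (d + 1) (i + d + 1) = F.gridPoint (i + 1) := by
    rw [extKnot_eq_gridPoint]; congr 1; omega
  have hsub : Function.support (F.bspline (d + 1) i) ⊆
      Icc (F.gridPoint (i - d)) (F.gridPoint (i + 1)) := fun x hx => by
    have := F.mem_Icc_of_bsplineAux_ne_zero d d i x hx
    rwa [e] at this
  have hsup : Ioo (F.gridPoint (i - d)) (F.gridPoint (i + 1)) \ range F.gridPoint ⊆
      Function.support (F.bspline (d + 1) i) := fun x hx =>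
    (F.bsplineAux_pos d d i hx.2 hx.1.1 (by rw [e]; exact hx.1.2)).ne'
  apply le_antisymm
  · rw [← Real.volume_Icc]
    exact measure_mono (closure_minimal hsub isClosed_Icc)
  · rw [← Real.volume_Ioo, ← measure_sdiff_null ((countable_range F.gridPoint).measure_zero volume)]
    exact measure_mono (hsup.trans subset_closure)

theorem gridPoint_sub_le_mul_of_regularity_le (F : IntervalPartition) {d : ℕ} {γ : ℝ≥0}
    (hF : F.regularity (d + 1) ≤ γ) {i : ℕ} (hi : i + 1 < F.numAtoms + d) :
    F.gridPoint (i + 1) - F.gridPoint (i - d) ≤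
        γ * (F.gridPoint (i + 2) - F.gridPoint (i + 1 - d)) ∧
    F.gridPoint (i + 2) - F.gridPoint (i + 1 - d) ≤
        γ * (F.gridPoint (i + 1) - F.gridPoint (i - d)) := by
  have h1 : 0 < F.gridPoint (i + 1) - F.gridPoint (i - d) :=
    sub_pos.2 (F.gridPoint_lt (by omega) (by have := F.numAtoms_pos; omega))
  have h2 : 0 < F.gridPoint (i + 2) - F.gridPoint (i + 1 - d) :=
    sub_pos.2 (F.gridPoint_lt (by omega) (by have := F.numAtoms_pos; omega))
  have h := (le_iSup₂ (f := fun i (_ : i ∈ Finset.range (F.numAtoms + (d + 1) - 2)) =>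
    max (volume (F.bsplineSupport (d + 1) i) / volume (F.bsplineSupport (d + 1) (i + 1)))
      (volume (F.bsplineSupport (d + 1) (i + 1)) / volume (F.bsplineSupport (d + 1) i)))
    i (Finset.mem_range.2 (by omega))).trans hF
  simp only [volume_bsplineSupport, max_le_iff] at h
  have key : ∀ {x y : ℝ}, 0 < x → 0 < y → ENNReal.ofReal x / ENNReal.ofReal y ≤ γ →
      x ≤ γ * y := by
    intro x y hx hy hxy
    rw [ENNReal.div_le_iff (by simpa using hy) ENNReal.ofReal_ne_top,
      ← ENNReal.ofReal_coe_nnreal, ← ENNReal.ofReal_mul γ.coe_nonneg,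
      ENNReal.ofReal_le_ofReal_iff (by positivity)] at hxy
    exact hxy
  exact ⟨key h1 h2 h.1, key h2 h1 h.2⟩

theorem gridPoint_sub_le_pow_mul (F : IntervalPartition) {d : ℕ} {γ : ℝ≥0}
    (hF : F.regularity (d + 1) ≤ γ) (n : ℕ) {i : ℕ} (hi : i + n < F.numAtoms + d) :
    F.gridPoint (i + 1) - F.gridPoint (i - d) ≤
        max 1 (γ : ℝ) ^ n * (F.gridPoint (i + n + 1) - F.gridPoint (i + n - d)) ∧
    F.gridPoint (i + n + 1) - F.gridPoint (i + n - d) ≤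
        max 1 (γ : ℝ) ^ n * (F.gridPoint (i + 1) - F.gridPoint (i - d)) := by
  induction n with
  | zero => simp
  | succ n ih =>
    have ih := ih (by omega)
    have h := F.gridPoint_sub_le_mul_of_regularity_le hF (i := i + n) (by omega)
    have hG : (γ : ℝ) ≤ max 1 (γ : ℝ) := le_max_right _ _
    have hG0 : (0 : ℝ) ≤ max 1 (γ : ℝ) := zero_le_one.trans (le_max_left _ _)
    have p1 : 0 ≤ F.gridPoint (i + n + 1) - F.gridPoint (i + n - d) :=
      sub_nonneg.2 (F.gridPoint_mono (by omega))
    have p2 : 0 ≤ F.gridPoint (i + n + 2) - F.gridPoint (i + n + 1 - d) :=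
      sub_nonneg.2 (F.gridPoint_mono (by omega))
    rw [show i + (n + 1) + 1 = i + n + 2 by omega, show i + (n + 1) - d = i + n + 1 - d by omega]
    constructor
    · refine ih.1.trans ?_
      rw [pow_succ, mul_assoc]
      exact mul_le_mul_of_nonneg_left (h.1.trans (mul_le_mul_of_nonneg_right hG p2)) (by positivity)
    · refine h.2.trans ((mul_le_mul_of_nonneg_right hG p1).trans ?_)
      rw [pow_succ', mul_assoc]
      exact mul_le_mul_of_nonneg_left ih.2 hG0

/-- Regularity bounds the length of a neighbourhood of a dominant atom. -/
theorem gridPoint_sub_le_of_isDominant (F : IntervalPartition) {d : ℕ} {γ : ℝ≥0}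
    (hF : F.regularity (d + 1) ≤ γ) {a : Fin F.numAtoms} (ha : F.IsDominant d a) (R : ℕ) :
    F.gridPoint (a + R + 1) - F.gridPoint (a - R) ≤
      (2 * R + 1) * max 1 (γ : ℝ) ^ R * (d + 1) * F.width a := by
  obtain ⟨i, hai, hia, hdom⟩ := ha
  have hlen := F.gridPoint_sub_le (F.width_pos a).le hdom
  have hG1 : (1 : ℝ) ≤ max 1 (γ : ℝ) := le_max_left _ _
  have hwa := F.width_pos a
  have hb : ∀ b : Fin F.numAtoms, (b : ℕ) ≤ a + R → a + R ≤ b + 2 * R →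
      F.width b ≤ max 1 (γ : ℝ) ^ R * ((d + 1) * F.width a) := by
    intro b h1 h2
    have hbm := b.2
    have ham := a.2
    -- `b` lies in the support with index `i + b - a`.
    have key : ∀ j n, (b : ℕ) ≤ j → j ≤ b + d → n ≤ R →
        F.gridPoint (j + 1) - F.gridPoint (j - d) ≤
          max 1 (γ : ℝ) ^ n * (F.gridPoint (i + 1) - F.gridPoint (i - d)) →
        F.width b ≤ max 1 (γ : ℝ) ^ R * ((d + 1) * F.width a) := by
      intro j n hj1 hj2 hn h
      have h3 : F.width b ≤ F.gridPoint (j + 1) - F.gridPoint (j - d) :=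
        sub_le_sub (F.gridPoint_mono (by omega)) (F.gridPoint_mono (by omega))
      refine h3.trans (h.trans (mul_le_mul (pow_le_pow_right₀ hG1 hn) hlen ?_ (by positivity)))
      exact sub_nonneg.2 (F.gridPoint_mono (by omega))
    rcases le_total (a : ℕ) b with hab | hab
    · have := (F.gridPoint_sub_le_pow_mul hF (b - a) (i := i) (by omega)).2
      exact key (i + (b - a)) (b - a) (by omega) (by omega) (by omega) this
    · have := (F.gridPoint_sub_le_pow_mul hF (a - b) (i := i - (a - b)) (by omega)).1
      rw [show i - (a - b) + (a - b) = i by omega] at this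
      exact key (i - (a - b)) (a - b) (by omega) (by omega) (by omega) this
  have := F.gridPoint_sub_le (by positivity) hb
  rw [show (a : ℕ) + R - 2 * R = a - R by omega] at this
  push_cast at this
  linarith

/-! ### Refinement of partitions -/

theorem exists_atom_subset_atom {F G : IntervalPartition} (h : F.sigmaAlgebra ≤ G.sigmaAlgebra)
    (b : Fin G.numAtoms) : ∃ a, G.atom b ⊆ F.atom a := by
  have hmeas : ∀ s : Set (Icc (0 : ℝ) 1), MeasurableSet[G.sigmaAlgebra] s →
      (Subtype.val ⁻¹' G.atom b ⊆ s ∨ Subtype.val ⁻¹' G.atom b ⊆ sᶜ) := by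
    intro s hs
    induction s, hs using MeasurableSpace.generateFrom_induction with
    | hC t ht _ =>
      obtain ⟨c, rfl⟩ := ht
      by_cases hcb : c = b
      · exact Or.inl (by rw [hcb])
      · exact Or.inr fun x hx hxc => hcb (G.eq_of_mem_atom hxc hx)
    | empty => exact Or.inr (by simp)
    | compl t _ ht => rw [compl_compl]; exact ht.symm
    | iUnion t _ ht =>
      by_cases hex : ∃ n, Subtype.val ⁻¹' G.atom b ⊆ t n
      · obtain ⟨n, hn⟩ := hex
        exact Or.inl (hn.trans (subset_iUnion t n))
      · push Not at hex
        refine Or.inr ?_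
        rw [compl_iUnion]
        exact subset_iInter fun n => (ht n).resolve_left (hex n)
  have hz := G.node_mem_atom (d := 0) b le_rfl
  have hz1 := G.atom_subset_Icc_zero_one b hz
  obtain ⟨a, ha⟩ := F.exists_mem_atom hz1
  refine ⟨a, fun x hx => ?_⟩
  have hx1 := G.atom_subset_Icc_zero_one b hx
  rcases hmeas _ (h _ (MeasurableSpace.measurableSet_generateFrom ⟨a, rfl⟩)) with h1 | h1
  · exact @h1 ⟨x, hx1⟩ hx
  · exact absurd ha (@h1 ⟨_, hz1⟩ hz)

theorem splineSpace_mono {F G : IntervalPartition} (h : F.sigmaAlgebra ≤ G.sigmaAlgebra) (k : ℕ) :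
    F.splineSpace k ≤ G.splineSpace k := by
  rintro f ⟨hf, hf'⟩
  refine ⟨hf, fun b => ?_⟩
  obtain ⟨a, ha⟩ := exists_atom_subset_atom h b
  obtain ⟨p, hp, hp'⟩ := hf' a
  exact ⟨p, hp, fun x hx => hp' x (ha hx)⟩

/-- Passing to a coarser partition does not increase the distance between indices of atoms. -/
theorem le_add_of_sigmaAlgebra_le {F G : IntervalPartition} (h : F.sigmaAlgebra ≤ G.sigmaAlgebra)
    {a a' : Fin F.numAtoms} {b b' : Fin G.numAtoms} {x y : ℝ} (hxa : x ∈ F.atom a)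
    (hya : y ∈ F.atom a') (hxb : x ∈ G.atom b) (hyb : y ∈ G.atom b') {n : ℕ}
    (hbb : (b' : ℕ) ≤ b + n) : (a' : ℕ) ≤ a + n := by
  choose α hα using exists_atom_subset_atom h
  have hmid : ∀ b, G.node 0 b 0 ∈ G.atom b := fun b => G.node_mem_atom b le_rfl
  have hαmono : ∀ b c : Fin G.numAtoms, b ≤ c → α b ≤ α c := by
    intro b c hbc
    rcases hbc.eq_or_lt with rfl | hlt
    · exact le_rfl
    · by_contra! hcon
      have hle : G.node 0 b 0 ≤ G.node 0 c 0 :=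
        (G.atom_subset b (hmid b)).2.trans
          ((G.gridPoint_mono (by exact_mod_cast hlt)).trans (G.atom_subset c (hmid c)).1)
      exact absurd (F.le_of_mem_atom_of_le (hα b (hmid b)) (hα c (hmid c)) hle) (not_le.2 hcon)
  have hstep : ∀ b c : Fin G.numAtoms, (c : ℕ) = b + 1 → (α c : ℕ) ≤ α b + 1 := by
    intro b c hbc
    by_contra! hcon
    -- The atom of the coarse partition with index `α b + 1` would be missed by `α`.
    set e : Fin F.numAtoms := ⟨α b + 1, by have := (α c).2; omega⟩ with he
    have hze := F.node_mem_atom (d := 0) e le_rfl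
    obtain ⟨c', hc'⟩ := G.exists_mem_atom (F.atom_subset_Icc_zero_one e hze)
    have hce : α c' = e := F.eq_of_mem_atom (hα c' hc') hze
    have hce' : (α c' : ℕ) = α b + 1 := by rw [hce]
    rcases le_or_gt c' b with h1 | h1
    · have h2 : (α c' : ℕ) ≤ α b := hαmono _ _ h1
      omega
    · have h3 : c ≤ c' := by
        have : (b : ℕ) < c' := h1
        exact (by omega : (c : ℕ) ≤ c')
      have h2 : (α c : ℕ) ≤ α c' := hαmono _ _ h3
      omega
  have hlip : ∀ n, ∀ b c : Fin G.numAtoms, (c : ℕ) ≤ b + n → (α c : ℕ) ≤ α b + n := by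
    intro n
    induction n with
    | zero => intro b c hbc; exact hαmono c b (by simpa using hbc)
    | succ n ih =>
      intro b c hbc
      rcases Nat.lt_or_ge (b + n) c with h1 | h1
      · have hc := c.2
        have h2 := hstep ⟨b + n, by omega⟩ c (by simp; omega)
        have h3 := ih b ⟨b + n, by omega⟩ le_rfl
        omega
      · exact (ih b c h1).trans (by omega)
  have := hlip n b b' hbb
  rwa [F.eq_of_mem_atom (hα b hxb) hxa, F.eq_of_mem_atom (hα b' hyb) hya] at this

end IntervalPartition

/-! ### Splines dominating the square function -/

/-- The maximum of `0` and the first `n` terms of a sequence. -/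
noncomputable def runMax (u : ℕ → ℝ) : ℕ → ℝ
  | 0 => 0
  | n + 1 => max (runMax u n) (u n)

theorem runMax_le_succ (u : ℕ → ℝ) (n : ℕ) : runMax u n ≤ runMax u (n + 1) := le_max_left _ _

theorem runMax_nonneg (u : ℕ → ℝ) (n : ℕ) : 0 ≤ runMax u n := by
  induction n with
  | zero => exact le_rfl
  | succ n ih => exact ih.trans (runMax_le_succ u n)

theorem runMax_congr {u v : ℕ → ℝ} {n : ℕ} (h : ∀ l < n, u l = v l) : runMax u n = runMax v n := by
  induction n with
  | zero => rfl
  | succ n ih =>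
    rw [runMax, runMax, ih fun l hl => h l (hl.trans (Nat.lt_succ_self n)), h n (Nat.lt_succ_self n)]

theorem sum_runMax_sub (u : ℕ → ℝ) (n : ℕ) :
    ∑ l ∈ Finset.range n, (runMax u (l + 1) - runMax u l) = runMax u n := by
  rw [Finset.sum_range_sub]; simp [runMax]

/-- The increments that lead to values not exceeding a threshold add up to at most the threshold. -/
theorem sum_ite_runMax_sub_le (u : ℕ → ℝ) {R : ℝ} (hR : 0 ≤ R) (n : ℕ) :
    ∑ l ∈ Finset.range n, (if runMax u (l + 1) ≤ R then runMax u (l + 1) - runMax u l else 0) ≤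
      R := by
  suffices H : ∑ l ∈ Finset.range n,
      (if runMax u (l + 1) ≤ R then runMax u (l + 1) - runMax u l else 0) ≤
        min (runMax u n) R from H.trans (min_le_right _ _)
  induction n with
  | zero => simp [runMax, hR]
  | succ n ih =>
    rw [Finset.sum_range_succ]
    have h := runMax_le_succ u n
    split_ifs with h1
    · rw [min_eq_left h1]
      have := ih.trans (min_le_left _ _)
      linarith
    · rw [add_zero]
      exact ih.trans (min_le_min_right _ h)

/-- The sum of the squares of the first `n` functions. -/
def sqSum (f : ℕ → ℝ → ℝ) (n : ℕ) (x : ℝ) : ℝ := ∑ l ∈ Finset.range n, f l x ^ 2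

theorem sqSum_nonneg (f : ℕ → ℝ → ℝ) (n : ℕ) (x : ℝ) : 0 ≤ sqSum f n x :=
  Finset.sum_nonneg fun _ _ => sq_nonneg _

theorem sqSum_mono (f : ℕ → ℝ → ℝ) {m n : ℕ} (h : m ≤ n) (x : ℝ) : sqSum f m x ≤ sqSum f n x :=
  Finset.sum_le_sum_of_subset_of_nonneg (Finset.range_mono h) fun _ _ _ => sq_nonneg _

theorem measurable_sqSum {f : ℕ → ℝ → ℝ} (hf : ∀ n, Measurable (f n)) (n : ℕ) :
    Measurable (sqSum f n) := by
  unfold sqSum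
  exact Finset.measurable_sum _ fun l _ => (hf l).pow_const 2

theorem exists_sqrt_sqSum_le {f : ℕ → ℝ → ℝ} (hf : ∀ n, ∃ C, ∀ x, ‖f n x‖ ≤ C) (n : ℕ) :
    ∃ C, ∀ x, √(sqSum f n x) ≤ C := by
  choose C hC using hf
  refine ⟨√(∑ l ∈ Finset.range n, C l ^ 2), fun x => Real.sqrt_le_sqrt ?_⟩
  refine Finset.sum_le_sum fun l _ => ?_
  rw [← sq_abs]
  exact pow_le_pow_left₀ (abs_nonneg _) (hC l x) 2

theorem integrableOn_sqrt_sqSum {f : ℕ → ℝ → ℝ} (hfm : ∀ n, Measurable (f n))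
    (hfb : ∀ n, ∃ C, ∀ x, ‖f n x‖ ≤ C) (n : ℕ) :
    IntegrableOn (fun x => √(sqSum f n x)) (Icc 0 1) := by
  obtain ⟨C, hC⟩ := exists_sqrt_sqSum_le hfb n
  refine Measure.integrableOn_of_bounded (M := C) (by simp)
    (measurable_sqSum hfm n).sqrt.aestronglyMeasurable (Filter.Eventually.of_forall fun x => ?_)
  rw [Real.norm_of_nonneg (Real.sqrt_nonneg _)]
  exact hC x

namespace IntervalPartition

open Classical in
/-- The size of a nonnegative function at the nodes of a dominant atom, and `0` on other atoms. -/
noncomputable def nodeHeight (F : IntervalPartition) (d : ℕ) (g : ℝ → ℝ) (a : Fin F.numAtoms) : ℝ :=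
  if F.IsDominant d a then √(∑ i ∈ Finset.range (d + 1), g (F.node d a i)) else 0

/-- The function that is constant on each atom, with value `nodeHeight`. -/
noncomputable def heightFun (F : IntervalPartition) (d : ℕ) (g : ℝ → ℝ) (x : ℝ) : ℝ :=
  ∑ a, (F.atom a).indicator (fun _ => F.nodeHeight d g a) x

theorem heightFun_eq (F : IntervalPartition) (d : ℕ) (g : ℝ → ℝ) {a : Fin F.numAtoms} {x : ℝ}
    (hx : x ∈ F.atom a) : F.heightFun d g x = F.nodeHeight d g a := by
  rw [heightFun, Finset.sum_eq_single a]
  · exact indicator_of_mem hx _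
  · exact fun b _ hb => indicator_of_notMem (fun h => hb (F.eq_of_mem_atom h hx)) _
  · simp

theorem measurable_heightFun (F : IntervalPartition) (d : ℕ) (g : ℝ → ℝ) :
    Measurable (F.heightFun d g) :=
  Finset.measurable_sum _ fun a _ => measurable_const.indicator (F.measurableSet_atom a)

theorem integral_eq_sum_atom (F : IntervalPartition) {g : ℝ → ℝ} (hg : IntegrableOn g (Icc 0 1)) :
    ∫ x in Icc (0 : ℝ) 1, g x = ∑ a, ∫ x in F.atom a, g x := by
  rw [← F.iUnion_atom]
  exact integral_iUnion_fintype F.measurableSet_atom F.disjoint_atom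
    fun a => hg.mono_set (F.atom_subset_Icc_zero_one a)

/-- On a fixed proportion of each atom, the sum of squares of splines is comparable to its values
at the nodes. -/
theorem exists_nodeHeight_le (F : IntervalPartition) (d : ℕ) {f : ℕ → ℝ → ℝ} {n : ℕ}
    (hf : ∀ l < n, f l ∈ F.splineSpace (d + 1)) (a : Fin F.numAtoms) :
    ∃ v, Ioo v (v + F.width a / (2 * (2 * d : ℕ) + 1)) ⊆ F.atom a ∧
      ∀ x ∈ Ioo v (v + F.width a / (2 * (2 * d : ℕ) + 1)), F.nodeHeight d (sqSum f n) a ≤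
        √((d + 1) * (((2 * d : ℕ) + 1) * (2 * (2 * d : ℕ) + 1) ^ (2 * d))) * √(sqSum f n x) := by
  have hp : ∀ l, ∃ p : ℝ[X], l < n → p.degree < (d + 1 : ℕ) ∧ ∀ x ∈ F.atom a, f l x = p.eval x :=
    fun l => by
      by_cases hl : l < n
      · obtain ⟨p, hp⟩ := (hf l hl).2 a
        exact ⟨p, fun _ => hp⟩
      · exact ⟨0, fun h => absurd h hl⟩
  choose p hp using hp
  set q : ℝ[X] := ∑ l ∈ Finset.range n, p l ^ 2 with hq
  have hqf : ∀ x ∈ F.atom a, sqSum f n x = q.eval x := by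
    intro x hx
    rw [hq, Polynomial.eval_finsetSum, sqSum]
    exact Finset.sum_congr rfl fun l hl => by
      rw [Polynomial.eval_pow, (hp l (Finset.mem_range.1 hl)).2 x hx]
  have hqd : q.degree < (2 * d + 1 : ℕ) := by
    refine (Polynomial.degree_sum_le _ _).trans_lt
      ((Finset.sup_lt_iff (WithBot.bot_lt_coe _)).2 fun l hl => ?_)
    have h1 := (hp l (Finset.mem_range.1 hl)).1
    have h2 : (p l).natDegree ≤ d := Polynomial.natDegree_le_of_degree_le (Order.lt_succ_iff.1 h1)
    refine (Polynomial.degree_le_natDegree).trans_lt ?_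
    have h3 := Polynomial.natDegree_pow_le (p := p l) (n := 2)
    exact_mod_cast (by omega : (p l ^ 2).natDegree < 2 * d + 1)
  obtain ⟨v, hv1, hv2, hv⟩ := Polynomial.exists_subinterval_abs_eval_le (2 * d) hqd
    (u := F.gridPoint a) (F.width_pos a)
  have hwa : F.gridPoint a + F.width a = F.gridPoint (a + 1) := by unfold width; ring
  have hsub : Ioo v (v + F.width a / (2 * (2 * d : ℕ) + 1)) ⊆ F.atom a := fun x hx =>
    F.Ioo_subset a ⟨hv1.trans_lt hx.1, hx.2.trans_le (hv2.trans_eq hwa)⟩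
  refine ⟨v, hsub, fun x hx => ?_⟩
  rw [nodeHeight]
  split_ifs
  · rw [← Real.sqrt_mul (by positivity)]
    refine Real.sqrt_le_sqrt ?_
    calc ∑ i ∈ Finset.range (d + 1), sqSum f n (F.node d a i)
        ≤ ∑ _i ∈ Finset.range (d + 1),
          ((2 * d : ℕ) + 1) * (2 * (2 * d : ℕ) + 1) ^ (2 * d) * sqSum f n x := by
          refine Finset.sum_le_sum fun i hi => ?_
          have hn := F.node_mem_atom a (Nat.lt_succ_iff.1 (Finset.mem_range.1 hi))
          have h1 := hv x (Ioo_subset_Icc_self hx) _ (by rw [hwa]; exact F.atom_subset a hn)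
          rw [← hqf _ hn, ← hqf x (hsub hx), abs_of_nonneg (sqSum_nonneg _ _ _),
            abs_of_nonneg (sqSum_nonneg _ _ _)] at h1
          exact h1
      _ = _ := by
          rw [Finset.sum_const, Finset.card_range, nsmul_eq_mul]; push_cast; ring
  · positivity

/-- The square function of splines from an increasing sequence of partitions is dominated by sums of
nonnegative splines from the same partitions, with comparable integrals.

The value of the square function at a point is controlled by its values on dominant atoms nearby.
Whenever the latter reach a new maximum on a dominant atom, the increment times a bump around that
atom is added. Later atoms inside the dominant atom stay in the region where the bump equals `1`,
together with their neighbours. -/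
theorem exists_spline_majorant (d : ℕ) (γ : ℝ≥0) : ∃ C : ℝ, 0 < C ∧
    ∀ (F : ℕ → IntervalPartition)
      (_ : ∀ m n, m ≤ n → (F m).sigmaAlgebra ≤ (F n).sigmaAlgebra)
      (_ : ∀ n, (F n).regularity (d + 1) ≤ (γ : ℝ≥0∞))
      (f : ℕ → ℝ → ℝ) (_ : ∀ n, f n ∈ (F n).splineSpace (d + 1))
      (_ : ∀ n, Measurable (f n)) (_ : ∀ n, ∃ C, ∀ x, ‖f n x‖ ≤ C),
      ∃ y : ℕ → ℝ → ℝ, (∀ n, y n ∈ (F n).splineSpace (d + 1)) ∧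
        (∀ n, ∀ x ∈ Icc (0 : ℝ) 1, 0 ≤ y n x) ∧
        (∀ n, ∀ x ∈ Icc (0 : ℝ) 1,
          √(sqSum f (n + 1) x) ≤ C * ∑ j ∈ Finset.range (n + 1), y j x) ∧
        ∀ N, ∑ n ∈ Finset.range N, ∫ x in Icc (0 : ℝ) 1, y n x ≤
          C * ∫ x in Icc (0 : ℝ) 1, √(sqSum f N x) := by
  obtain ⟨K, hK0, hK⟩ := exists_sq_le_sum_node d
  obtain ⟨R, hR⟩ := exists_bump_mem_splineSpace d
  set A : ℝ := (2 * R + 1) * max 1 (γ : ℝ) ^ R * (d + 1) with hA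
  set B : ℝ := √((d + 1) * (((2 * d : ℕ) + 1) * (2 * (2 * d : ℕ) + 1) ^ (2 * d))) with hB
  set T : ℝ := 2 * (2 * d : ℕ) + 1 with hT
  have hT0 : 0 < T := by positivity
  have hB0 : 0 ≤ B := Real.sqrt_nonneg _
  have hA0 : 0 < A := by
    have : (0 : ℝ) < max 1 (γ : ℝ) := zero_lt_one.trans_le (le_max_left _ _)
    positivity
  refine ⟨max (√(K * (2 * d + 1))) (A * T * B) + 1, by positivity, ?_⟩
  intro F hF hreg f hf hfm hfb
  have hfS : ∀ n l, l < n + 1 → f l ∈ (F n).splineSpace (d + 1) := fun n l hl =>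
    splineSpace_mono (hF l n (Nat.lt_succ_iff.1 hl)) _ (hf l)
  set u : ℝ → ℕ → ℝ := fun x n => (F n).heightFun d (sqSum f (n + 1)) x with hu
  set δ : ℕ → ℝ → ℝ := fun n x => runMax (u x) (n + 1) - runMax (u x) n with hδ
  have hδ0 : ∀ n x, 0 ≤ δ n x := fun n x => sub_nonneg.2 (runMax_le_succ _ _)
  -- The increments of order `n` are constant on the atoms of the partition with index `n`.
  have hconst : ∀ n (a : Fin (F n).numAtoms) x z, x ∈ (F n).atom a → z ∈ (F n).atom a →
      ∀ l ≤ n + 1, runMax (u x) l = runMax (u z) l := by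
    intro n a x z hx hz l hl
    refine runMax_congr fun j hj => ?_
    obtain ⟨b, hb⟩ := exists_atom_subset_atom (hF j n (by omega)) a
    simp only [hu]
    rw [(F j).heightFun_eq _ _ (hb hx), (F j).heightFun_eq _ _ (hb hz)]
  have hδc : ∀ n (a : Fin (F n).numAtoms) x z, x ∈ (F n).atom a → z ∈ (F n).atom a →
      δ n x = δ n z := fun n a x z hx hz => by
    simp only [hδ]
    rw [hconst n a x z hx hz _ le_rfl, hconst n a x z hx hz _ (Nat.le_succ n)]
  have hpt : ∀ n (a : Fin (F n).numAtoms), (F n).node d a 0 ∈ (F n).atom a := fun n a =>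
    (F n).node_mem_atom a (Nat.zero_le d)
  choose φ hφS hφ0 hφ1 hφI using fun n (a : Fin (F n).numAtoms) => hR (F n) a
  set y : ℕ → ℝ → ℝ := fun n => ∑ a, δ n ((F n).node d a 0) • φ n a with hy
  have hyS : ∀ n, y n ∈ (F n).splineSpace (d + 1) := fun n =>
    Submodule.sum_mem _ fun a _ => Submodule.smul_mem _ _ (hφS n a)
  have hyx : ∀ n x, y n x = ∑ a, δ n ((F n).node d a 0) * φ n a x := fun n x => by
    simp only [hy, Finset.sum_apply, Pi.smul_apply, smul_eq_mul]
  have hy0 : ∀ n, ∀ x ∈ Icc (0 : ℝ) 1, 0 ≤ y n x := fun n x hx => by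
    rw [hyx]
    exact Finset.sum_nonneg fun a _ => mul_nonneg (hδ0 _ _) (hφ0 n a x hx)
  have hdom : ∀ n, ∀ x ∈ Icc (0 : ℝ) 1,
      √(sqSum f (n + 1) x) ≤ √(K * (2 * d + 1)) * ∑ j ∈ Finset.range (n + 1), y j x := by
    intro n x hx
    obtain ⟨a, ha⟩ := (F n).exists_mem_atom hx
    set Y := ∑ j ∈ Finset.range (n + 1), y j x with hY
    have hY0 : 0 ≤ Y := Finset.sum_nonneg fun j _ => hy0 j x hx
    have hheight : ∀ b ∈ (F n).dominantNear d a,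
        (F n).nodeHeight d (sqSum f (n + 1)) b ≤ Y := by
      intro b hb
      have hb' := (F n).mem_dominantNear.1 hb
      set z := (F n).node d b 0 with hz
      have hzb : z ∈ (F n).atom b := hpt n b
      have hz1 := (F n).atom_subset_Icc_zero_one b hzb
      rw [← (F n).heightFun_eq d _ hzb]
      refine (le_max_right (runMax (u z) n) (u z n)).trans ?_
      change runMax (u z) (n + 1) ≤ Y
      rw [← sum_runMax_sub]
      refine Finset.sum_le_sum fun l hl => ?_
      have hln : l ≤ n := Nat.lt_succ_iff.1 (Finset.mem_range.1 hl)
      obtain ⟨c, hc⟩ := (F l).exists_mem_atom hz1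
      obtain ⟨e, he⟩ := (F l).exists_mem_atom hx
      have h1 := le_add_of_sigmaAlgebra_le (hF l n hln) hc he hzb ha hb'.2.2
      have h2 := le_add_of_sigmaAlgebra_le (hF l n hln) he hc ha hzb hb'.2.1
      rw [hyx]
      refine le_trans (le_of_eq ?_) (Finset.single_le_sum
        (f := fun a => δ l ((F l).node d a 0) * φ l a x)
        (fun a _ => mul_nonneg (hδ0 _ _) (hφ0 l a x hx)) (Finset.mem_univ c))
      change δ l z = δ l ((F l).node d c 0) * φ l c x
      rw [hφ1 l c e h2 h1 x he, mul_one]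
      exact hδc l c _ _ hc (hpt l c)
    have hsq : sqSum f (n + 1) x ≤ K * (2 * d + 1) * Y ^ 2 := by
      have hcard : (((F n).dominantNear d a).card : ℝ) ≤ 2 * d + 1 := by
        exact_mod_cast (F n).card_dominantNear_le d a
      calc sqSum f (n + 1) x
          ≤ ∑ l ∈ Finset.range (n + 1), K * ∑ b ∈ (F n).dominantNear d a,
              ∑ i ∈ Finset.range (d + 1), f l ((F n).node d b i) ^ 2 :=
            Finset.sum_le_sum fun l hl => hK (F n) (f l) (hfS n l (Finset.mem_range.1 hl)) a x ha
        _ = K * ∑ b ∈ (F n).dominantNear d a, ∑ i ∈ Finset.range (d + 1),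
              sqSum f (n + 1) ((F n).node d b i) := by
            rw [← Finset.mul_sum, Finset.sum_comm]
            congr 1
            refine Finset.sum_congr rfl fun b _ => ?_
            rw [Finset.sum_comm]
            rfl
        _ ≤ K * ∑ _b ∈ (F n).dominantNear d a, Y ^ 2 := by
            refine mul_le_mul_of_nonneg_left (Finset.sum_le_sum fun b hb => ?_) hK0
            have h1 := hheight b hb
            rw [nodeHeight, if_pos ((F n).mem_dominantNear.1 hb).1] at h1
            exact (Real.sqrt_le_left hY0).1 h1
        _ ≤ K * (2 * d + 1) * Y ^ 2 := by
            rw [Finset.sum_const, nsmul_eq_mul, ← mul_assoc]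
            gcongr
    calc √(sqSum f (n + 1) x) ≤ √(K * (2 * d + 1) * Y ^ 2) := Real.sqrt_le_sqrt hsq
      _ = _ := by rw [Real.sqrt_mul (by positivity), Real.sqrt_sq hY0]
  refine ⟨y, hyS, hy0, fun n x hx => (hdom n x hx).trans ?_, fun N => ?_⟩
  · refine mul_le_mul_of_nonneg_right ?_ (Finset.sum_nonneg fun j _ => hy0 j x hx)
    exact (le_max_left _ _).trans (by linarith)
  have hSint := integrableOn_sqrt_sqSum hfm hfb N
  have hS0 : 0 ≤ ∫ x in Icc (0 : ℝ) 1, √(sqSum f N x) := integral_nonneg fun x => Real.sqrt_nonneg _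
  suffices H : ∑ n ∈ Finset.range N, ∫ x in Icc (0 : ℝ) 1, y n x ≤
      A * T * B * ∫ x in Icc (0 : ℝ) 1, √(sqSum f N x) by
    refine H.trans (mul_le_mul_of_nonneg_right ?_ hS0)
    exact (le_max_right _ _).trans (by linarith)
  -- The increments, restricted to where they are visible in the final square function.
  set g : ℕ → ℝ → ℝ := fun n x =>
    if runMax (u x) (n + 1) ≤ B * √(sqSum f N x) then δ n x else 0 with hg
  have hum : ∀ n, Measurable fun x => runMax (u x) n := by
    intro n
    induction n with
    | zero => exact measurable_const
    | succ n ih => exact ih.max ((F n).measurable_heightFun d _)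
  have hgm : ∀ n, Measurable (g n) := fun n =>
    Measurable.ite (measurableSet_le (hum (n + 1)) ((measurable_sqSum hfm N).sqrt.const_mul B))
      ((hum (n + 1)).sub (hum n)) measurable_const
  have hg0 : ∀ n x, 0 ≤ g n x := fun n x => by
    simp only [hg]; split_ifs
    · exact hδ0 n x
    · exact le_rfl
  have hgS : ∀ n x, g n x ≤ B * √(sqSum f N x) := fun n x => by
    simp only [hg]
    split_ifs with h
    · have := runMax_nonneg (u x) n
      simp only [hδ]; linarith
    · positivity
  have hgi : ∀ n, IntegrableOn (g n) (Icc 0 1) := fun n =>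
    (hSint.const_mul B).mono' (hgm n).aestronglyMeasurable (Filter.Eventually.of_forall fun x => by
      rw [Real.norm_of_nonneg (hg0 n x)]; exact hgS n x)
  have hatom : ∀ n < N, ∀ a : Fin (F n).numAtoms,
      δ n ((F n).node d a 0) * (F n).width a ≤ T * ∫ x in (F n).atom a, g n x := by
    intro n hn a
    obtain ⟨v, hv1, hv2⟩ := (F n).exists_nodeHeight_le d (hfS n) a
    set J := Ioo v (v + (F n).width a / T)
    have hpos : 0 < (F n).width a / T := div_pos ((F n).width_pos a) hT0
    have hJ : ∀ x ∈ J, δ n ((F n).node d a 0) ≤ g n x := by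
      intro x hx
      have hxa := hv1 hx
      rw [hδc n a _ x (hpt n a) hxa]
      rcases (hδ0 n x).eq_or_lt with h | h
      · rw [← h]; exact hg0 n x
      · have h1 : runMax (u x) (n + 1) = u x n := by
          refine max_eq_right (le_of_lt ?_)
          by_contra! hcon
          refine h.ne' ?_
          simp only [hδ, runMax]
          rw [max_eq_left hcon, sub_self]
        have h2 : runMax (u x) (n + 1) ≤ B * √(sqSum f N x) := by
          rw [h1]
          simp only [hu]
          rw [(F n).heightFun_eq d _ hxa]
          exact (hv2 x hx).trans (mul_le_mul_of_nonneg_left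
            (Real.sqrt_le_sqrt (sqSum_mono f hn x)) hB0)
        simp only [hg]
        rw [if_pos h2]
    have hga := (hgi n).mono_set ((F n).atom_subset_Icc_zero_one a)
    calc δ n ((F n).node d a 0) * (F n).width a
        = T * ∫ _x in J, δ n ((F n).node d a 0) := by
          rw [setIntegral_const, Real.volume_real_Ioo_of_le (by linarith), smul_eq_mul]
          field_simp
          ring
      _ ≤ T * ∫ x in J, g n x := by
          refine mul_le_mul_of_nonneg_left ?_ hT0.le
          exact setIntegral_mono_on (integrableOn_const (by simp [J])) (hga.mono_set hv1)
            measurableSet_Ioo hJ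
      _ ≤ _ := by
          refine mul_le_mul_of_nonneg_left ?_ hT0.le
          exact setIntegral_mono_set hga (Filter.Eventually.of_forall (hg0 n))
            (Filter.Eventually.of_forall hv1)
  have hstep : ∀ n < N, ∫ x in Icc (0 : ℝ) 1, y n x ≤ A * T * ∫ x in Icc (0 : ℝ) 1, g n x := by
    intro n hn
    have h1 : ∫ x in Icc (0 : ℝ) 1, y n x =
        ∑ a, δ n ((F n).node d a 0) * ∫ x in Icc (0 : ℝ) 1, φ n a x := by
      simp only [hyx]
      rw [integral_finsetSum _ fun a _ =>
        ((F n).integrableOn_of_mem_splineSpace (hφS n a)).const_mul _]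
      exact Finset.sum_congr rfl fun a _ => integral_const_mul _ _
    rw [h1, (F n).integral_eq_sum_atom (hgi n), Finset.mul_sum]
    refine Finset.sum_le_sum fun a _ => ?_
    rcases (hδ0 n ((F n).node d a 0)).eq_or_lt with h | h
    · rw [← h, zero_mul]
      exact mul_nonneg (by positivity) (integral_nonneg fun x => hg0 n x)
    · -- A nonzero increment occurs only on dominant atoms.
      have hda : (F n).IsDominant d a := by
        by_contra hcon
        refine h.ne' ?_
        have : u ((F n).node d a 0) n = 0 := by
          simp only [hu]
          rw [(F n).heightFun_eq d _ (hpt n a), nodeHeight, if_neg hcon]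
        simp only [hδ, runMax]
        rw [this, max_eq_left (runMax_nonneg _ _), sub_self]
      have h2 := (hφI n a).trans ((F n).gridPoint_sub_le_of_isDominant (hreg n) hda R)
      calc _ ≤ δ n ((F n).node d a 0) * (A * (F n).width a) := by gcongr
        _ = A * (δ n ((F n).node d a 0) * (F n).width a) := by ring
        _ ≤ A * (T * ∫ x in (F n).atom a, g n x) :=
            mul_le_mul_of_nonneg_left (hatom n hn a) hA0.le
        _ = _ := by ring
  calc ∑ n ∈ Finset.range N, ∫ x in Icc (0 : ℝ) 1, y n x
      ≤ ∑ n ∈ Finset.range N, A * T * ∫ x in Icc (0 : ℝ) 1, g n x :=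
        Finset.sum_le_sum fun n hn => hstep n (Finset.mem_range.1 hn)
    _ = A * T * ∫ x in Icc (0 : ℝ) 1, ∑ n ∈ Finset.range N, g n x := by
        rw [← Finset.mul_sum, integral_finsetSum _ fun n _ => hgi n]
    _ ≤ A * T * ∫ x in Icc (0 : ℝ) 1, B * √(sqSum f N x) := by
        refine mul_le_mul_of_nonneg_left ?_ (by positivity)
        refine integral_mono (integrable_finsetSum _ fun n _ => hgi n) (hSint.const_mul B)
          fun x => ?_
        exact sum_ite_runMax_sub_le (u x) (by positivity) N
    _ = _ := by rw [integral_const_mul]; ring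

end IntervalPartition

/-! ### Duality -/

/-- The inequality of arithmetic and geometric means with weight `a`, where `a` and `b` are
consecutive values of a square function. -/
theorem abs_mul_le_of_sq_eq_sub {a b φ η t : ℝ} (hb : 0 ≤ b) (hba : b ≤ a)
    (hφ : φ ^ 2 = a ^ 2 - b ^ 2) (ht : 0 < t) :
    |φ * η| ≤ t * (a - b) + a * η ^ 2 / (2 * t) := by
  rcases (hb.trans hba).eq_or_lt with ha | ha
  · have hφ0 : φ = 0 := by
      have : φ ^ 2 ≤ 0 := by rw [hφ, ← ha]; nlinarith
      exact pow_eq_zero_iff two_ne_zero |>.1 (le_antisymm this (sq_nonneg φ))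
    have : b = 0 := by linarith
    simp [hφ0, ← ha, this]
  · have h1 : |φ * η| ≤ t * φ ^ 2 / (2 * a) + a * η ^ 2 / (2 * t) := by
      rw [div_add_div _ _ (by positivity) (by positivity), le_div_iff₀ (by positivity), abs_mul,
        ← sq_abs φ, ← sq_abs η]
      nlinarith [sq_nonneg (t * |φ| - a * |η|)]
    have h2 : t * φ ^ 2 / (2 * a) ≤ t * (a - b) := by
      rw [div_le_iff₀ (by positivity), hφ]
      have : 0 ≤ t * (a - b) := mul_nonneg ht.le (by linarith)
      nlinarith
    linarith

namespace IntervalPartition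

theorem integrableOn_mul_of_mem_splineSpace (F : IntervalPartition) {k : ℕ} {g s : ℝ → ℝ}
    (hg : IntegrableOn g (Icc 0 1)) (hs : s ∈ F.splineSpace k) :
    IntegrableOn (fun x => g x * s x) (Icc 0 1) := by
  obtain ⟨t, -, he, hm, C, hC⟩ := F.measurable_and_bounded_representative hs
  have h1 : IntegrableOn (fun x => g x * t x) (Icc 0 1) :=
    hg.mul_bdd hm.aestronglyMeasurable (Filter.Eventually.of_forall hC)
  exact h1.congr_fun (fun x hx => by simp only [he hx]) measurableSet_Icc

/-- The integral of an integrable function against a nonnegative spline only involves the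
projection of the function. -/
theorem integral_mul_le_of_splineProjSupNorm_le (F : IntervalPartition) {k : ℕ} {g s : ℝ → ℝ}
    (hg : IntegrableOn g (Icc 0 1)) {M : ℝ} (hM : 0 ≤ M)
    (h : F.splineProjSupNorm k g ≤ ENNReal.ofReal M) (hs : s ∈ F.splineSpace k)
    (hs0 : ∀ x ∈ Icc (0 : ℝ) 1, 0 ≤ s x) :
    ∫ x in Icc (0 : ℝ) 1, g x * s x ≤ M * ∫ x in Icc (0 : ℝ) 1, s x := by
  rw [splineProjSupNorm, dif_pos hg, eLpNorm_exponent_top] at h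
  obtain ⟨hp, hps⟩ := (F.exists_isSplineProj k hg).choose_spec
  change F.splineProj k g hg ∈ _ at hp
  set p := F.splineProj k g hg
  rw [← hps s hs, ← integral_const_mul]
  refine integral_mono_ae
    (F.integrableOn_mul_of_mem_splineSpace (F.integrableOn_of_mem_splineSpace hp) hs)
    ((F.integrableOn_of_mem_splineSpace hs).const_mul M) ?_
  filter_upwards [ae_le_eLpNormEssSup (f := p) (μ := volume.restrict (Icc (0 : ℝ) 1)),
    ae_restrict_mem measurableSet_Icc] with x hx hx1
  refine mul_le_mul_of_nonneg_right ?_ (hs0 x hx1)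
  have h1 := hx.trans h
  rw [Real.enorm_eq_ofReal_abs, ENNReal.ofReal_le_ofReal_iff hM] at h1
  exact (le_abs_self _).trans h1

/-- The duality inequality for measurable bounded splines, if the sup norms of the
projections are known to be bounded by `S ^ 2`. -/
theorem exists_sum_integral_le (d : ℕ) (γ : ℝ≥0) : ∃ C : ℝ, 0 < C ∧
    ∀ (F : ℕ → IntervalPartition)
      (_ : ∀ m n, m ≤ n → (F m).sigmaAlgebra ≤ (F n).sigmaAlgebra)
      (_ : ∀ n, (F n).regularity (d + 1) ≤ (γ : ℝ≥0∞))
      (f : ℕ → ℝ → ℝ) (_ : ∀ n, f n ∈ (F n).splineSpace (d + 1))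
      (_ : ∀ n, Measurable (f n)) (_ : ∀ n, ∃ C, ∀ x, ‖f n x‖ ≤ C)
      (h : ℕ → ℝ → ℝ) (_ : ∀ n, IntegrableOn (h n) (Icc 0 1)) (N : ℕ)
      (_ : ∀ n < N, IntegrableOn (fun x => ∑ l ∈ Finset.Ico n N, h l x ^ 2) (Icc 0 1))
      (S : ℝ) (_ : 0 ≤ S)
      (_ : ∀ n < N, (F n).splineProjSupNorm (d + 1) (fun x => ∑ l ∈ Finset.Ico n N, h l x ^ 2) ≤
        ENNReal.ofReal (S ^ 2)),
      ∑ n ∈ Finset.range N, ∫ x in Icc (0 : ℝ) 1, |f n x * h n x| ≤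
        C * (∫ x in Icc (0 : ℝ) 1, √(sqSum f N x)) * S := by
  obtain ⟨C, hC0, hC⟩ := exists_spline_majorant d γ
  refine ⟨1 + C * C / 2, by positivity, ?_⟩
  intro F hF hreg f hf hfm hfb h hh N hg S hS hgS
  obtain ⟨y, hyS, hy0, hdom, hyI⟩ := hC F hF hreg f hf hfm hfb
  set g : ℕ → ℝ → ℝ := fun n x => ∑ l ∈ Finset.Ico n N, h l x ^ 2
  set I := ∫ x in Icc (0 : ℝ) 1, √(sqSum f N x) with hI
  have hI0 : 0 ≤ I := integral_nonneg fun x => Real.sqrt_nonneg _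
  have hSint := integrableOn_sqrt_sqSum hfm hfb N
  have hgy : ∀ n < N, IntegrableOn (fun x => g n x * y n x) (Icc 0 1) := fun n hn =>
    (F n).integrableOn_mul_of_mem_splineSpace (hg n hn) (hyS n)
  have hfh : ∀ n, IntegrableOn (fun x => |f n x * h n x|) (Icc 0 1) := fun n => by
    obtain ⟨B, hB⟩ := hfb n
    exact ((hh n).bdd_mul (hfm n).aestronglyMeasurable (Filter.Eventually.of_forall hB)).abs
  have hpt : ∀ t, 0 < t → ∀ x ∈ Icc (0 : ℝ) 1, ∑ n ∈ Finset.range N, |f n x * h n x| ≤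
      t * √(sqSum f N x) + C / (2 * t) * ∑ n ∈ Finset.range N, g n x * y n x := by
    intro t ht x hx
    have hstep : ∀ n, |f n x * h n x| ≤ t * (√(sqSum f (n + 1) x) - √(sqSum f n x)) +
        C / (2 * t) * ∑ j ∈ Finset.range (n + 1), h n x ^ 2 * y j x := by
      intro n
      refine (abs_mul_le_of_sq_eq_sub (Real.sqrt_nonneg (sqSum f n x))
        (Real.sqrt_le_sqrt (sqSum_mono f (Nat.le_succ n) x)) ?_ ht).trans
        (add_le_add le_rfl ?_)
      · rw [Real.sq_sqrt (sqSum_nonneg _ _ _), Real.sq_sqrt (sqSum_nonneg _ _ _), sqSum, sqSum,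
          Finset.sum_range_succ]
        ring
      · rw [← Finset.mul_sum]
        calc √(sqSum f (n + 1) x) * h n x ^ 2 / (2 * t)
            ≤ C * (∑ j ∈ Finset.range (n + 1), y j x) * h n x ^ 2 / (2 * t) := by
              gcongr; exact hdom n x hx
          _ = _ := by ring
    refine (Finset.sum_le_sum fun n _ => hstep n).trans_eq ?_
    rw [Finset.sum_add_distrib, ← Finset.mul_sum, ← Finset.mul_sum,
      Finset.sum_range_sub fun n => √(sqSum f n x)]
    congr 2
    · simp [sqSum]
    · simp only [g, Finset.sum_mul]
      refine Finset.sum_comm' fun n j => ?_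
      simp only [Finset.mem_range, Finset.mem_Ico]
      omega
  have hmain : ∀ t, 0 < t → S ≤ t →
      ∑ n ∈ Finset.range N, ∫ x in Icc (0 : ℝ) 1, |f n x * h n x| ≤ (1 + C * C / 2) * I * t := by
    intro t ht hSt
    have hsumi : IntegrableOn (fun x => ∑ n ∈ Finset.range N, g n x * y n x) (Icc 0 1) :=
      integrable_finsetSum _ fun n hn => hgy n (Finset.mem_range.1 hn)
    calc ∑ n ∈ Finset.range N, ∫ x in Icc (0 : ℝ) 1, |f n x * h n x|
        = ∫ x in Icc (0 : ℝ) 1, ∑ n ∈ Finset.range N, |f n x * h n x| :=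
          (integral_finsetSum _ fun n _ => hfh n).symm
      _ ≤ ∫ x in Icc (0 : ℝ) 1,
            (t * √(sqSum f N x) + C / (2 * t) * ∑ n ∈ Finset.range N, g n x * y n x) :=
          setIntegral_mono_on (integrable_finsetSum _ fun n _ => hfh n)
            ((hSint.const_mul t).add (hsumi.const_mul _)) measurableSet_Icc (hpt t ht)
      _ = t * I + C / (2 * t) * ∑ n ∈ Finset.range N, ∫ x in Icc (0 : ℝ) 1, g n x * y n x := by
          rw [integral_add (hSint.const_mul t) (hsumi.const_mul _), integral_const_mul,
            integral_const_mul, integral_finsetSum _ fun n hn => hgy n (Finset.mem_range.1 hn)]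
      _ ≤ t * I + C / (2 * t) * ∑ n ∈ Finset.range N, S ^ 2 * ∫ x in Icc (0 : ℝ) 1, y n x := by
          gcongr with n hn
          have hn' := Finset.mem_range.1 hn
          exact (F n).integral_mul_le_of_splineProjSupNorm_le (hg n hn') (sq_nonneg S) (hgS n hn')
            (hyS n) (hy0 n)
      _ ≤ t * I + C / (2 * t) * (t ^ 2 * (C * I)) := by
          rw [← Finset.mul_sum]
          gcongr
          · exact Finset.sum_nonneg fun n _ => setIntegral_nonneg measurableSet_Icc (hy0 n)
          · exact hyI N
      _ = (1 + C * C / 2) * I * t := by field_simp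
  have hlim : Filter.Tendsto (fun t => (1 + C * C / 2) * I * t) (nhdsWithin S (Ioi S))
      (nhds ((1 + C * C / 2) * I * S)) :=
    ((continuous_const.mul continuous_id).tendsto S).mono_left nhdsWithin_le_nhds
  refine ge_of_tendsto hlim ?_
  filter_upwards [self_mem_nhdsWithin] with t ht
  exact hmain t (hS.trans_lt ht) (le_of_lt ht)

end IntervalPartition

theorem mainTheorem3 (k : ℕ) (hk : 1 ≤ k) (γ : ℝ≥0) :
    ∃ C : ℝ≥0, ∀ (F : ℕ → IntervalPartition)
      (_ : ∀ m n, 1 ≤ m → m ≤ n → (F m).sigmaAlgebra ≤ (F n).sigmaAlgebra)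
      (_ : ∀ n, 1 ≤ n → (F n).regularity k ≤ (γ : ℝ≥0∞))
      (f : ℕ → ℝ → ℝ) (_ : ∀ n, 1 ≤ n → f n ∈ (F n).splineSpace k)
      (h : ℕ → ℝ → ℝ) (_ : ∀ n, 1 ≤ n → IntegrableOn (h n) (Icc 0 1))
      (N : ℕ),
      ∑ n ∈ Finset.Icc 1 N, ∫⁻ x in Icc (0 : ℝ) 1, ENNReal.ofReal |f n x * h n x| ≤
        (C : ℝ≥0∞) *
          (∫⁻ x in Icc (0 : ℝ) 1,
            ENNReal.ofReal (Real.sqrt (∑ l ∈ Finset.Icc 1 N, f l x ^ 2))) *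
          ⨆ n ∈ Finset.Icc 1 N,
            (F n).splineProjSupNorm k (fun x => ∑ l ∈ Finset.Icc n N, h l x ^ 2) ^
              (1 / 2 : ℝ) := by
  obtain ⟨d, rfl⟩ : ∃ d, k = d + 1 := ⟨k - 1, by omega⟩
  obtain ⟨C, hC0, hC⟩ := IntervalPartition.exists_sum_integral_le d γ
  refine ⟨C.toNNReal, fun F hF hreg f hf h hh N => ?_⟩
  have hshift : ∀ {M : Type} [AddCommMonoid M] (n : ℕ) (u : ℕ → M),
      ∑ l ∈ Finset.Icc (n + 1) N, u l = ∑ l ∈ Finset.Ico n N, u (l + 1) := fun n u => by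
    rw [Finset.sum_Ico_add']
    congr 1
  have hshift0 : ∀ {M : Type} [AddCommMonoid M] (u : ℕ → M),
      ∑ l ∈ Finset.Icc 1 N, u l = ∑ l ∈ Finset.range N, u (l + 1) := fun u => by
    rw [Finset.range_eq_Ico]; exact hshift 0 u
  -- Outside of `[0,1]` nothing is known about the splines, so they are modified there.
  choose f' hf' hff' hfm hfb using fun n : ℕ =>
    (F (n + 1)).measurable_and_bounded_representative (hf (n + 1) (by omega))
  have hSint := integrableOn_sqrt_sqSum hfm hfb N
  set I := ∫ x in Icc (0 : ℝ) 1, √(sqSum f' N x) with hI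
  have hIeq : ∫⁻ x in Icc (0 : ℝ) 1, ENNReal.ofReal (√(∑ l ∈ Finset.Icc 1 N, f l x ^ 2)) =
      ENNReal.ofReal I := by
    rw [hI, ofReal_integral_eq_lintegral_ofReal hSint
      (Filter.Eventually.of_forall fun x => Real.sqrt_nonneg _)]
    refine setLIntegral_congr_fun measurableSet_Icc fun x hx => ?_
    simp only [sqSum]
    rw [hshift0]
    congr 2
    exact Finset.sum_congr rfl fun l _ => by rw [hff' l hx]
  have hLeq : ∑ n ∈ Finset.Icc 1 N, ∫⁻ x in Icc (0 : ℝ) 1, ENNReal.ofReal |f n x * h n x| =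
      ∑ n ∈ Finset.range N, ∫⁻ x in Icc (0 : ℝ) 1, ENNReal.ofReal |f' n x * h (n + 1) x| := by
    rw [hshift0]
    refine Finset.sum_congr rfl fun n _ => setLIntegral_congr_fun measurableSet_Icc fun x hx => ?_
    simp only [hff' n hx]
  rw [hIeq, hLeq]
  set S := ⨆ n ∈ Finset.Icc 1 N, (F n).splineProjSupNorm (d + 1)
    (fun x => ∑ l ∈ Finset.Icc n N, h l x ^ 2) ^ (1 / 2 : ℝ) with hS
  have hI0 : 0 ≤ I := integral_nonneg fun x => Real.sqrt_nonneg _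
  have hCI : (C.toNNReal : ℝ≥0∞) = ENNReal.ofReal C := rfl
  rcases eq_or_ne S ⊤ with hST | hST
  · rcases hI0.eq_or_lt with h0 | h0
    · -- The square function vanishes almost everywhere, and so do all the splines.
      have hz := (integral_eq_zero_iff_of_nonneg (fun x => Real.sqrt_nonneg _) hSint).1 h0.symm
      refine le_of_eq_of_le (Finset.sum_eq_zero fun n hn => ?_) zero_le
      refine lintegral_eq_zero_of_ae_eq_zero ?_
      filter_upwards [hz] with x hx
      have h1 : sqSum f' N x = 0 := (Real.sqrt_eq_zero (sqSum_nonneg _ _ _)).1 hx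
      have h2 := (Finset.sum_eq_zero_iff_of_nonneg fun _ _ => sq_nonneg _).1 h1 n hn
      have h3 : f' n x = 0 := by simpa using h2
      simp [h3]
    · rw [hST, ENNReal.mul_top]
      · exact le_top
      · rw [hCI]
        exact mul_ne_zero (by simpa using hC0) (by simpa using h0)
  · have hnorm : ∀ n < N, (F (n + 1)).splineProjSupNorm (d + 1)
        (fun x => ∑ l ∈ Finset.Ico n N, h (l + 1) x ^ 2) ≤ ENNReal.ofReal (S.toReal ^ 2) := by
      intro n hn
      have h1 : (F (n + 1)).splineProjSupNorm (d + 1)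
          (fun x => ∑ l ∈ Finset.Icc (n + 1) N, h l x ^ 2) ^ (1 / 2 : ℝ) ≤ S :=
        le_iSup₂ (f := fun n (_ : n ∈ Finset.Icc 1 N) => (F n).splineProjSupNorm (d + 1)
          (fun x => ∑ l ∈ Finset.Icc n N, h l x ^ 2) ^ (1 / 2 : ℝ)) (n + 1)
          (Finset.mem_Icc.2 (by omega))
      simp only [hshift] at h1
      have h2 := ENNReal.rpow_le_rpow h1 (zero_le_two (α := ℝ))
      rw [← ENNReal.rpow_mul, show (1 / 2 * 2 : ℝ) = 1 by norm_num, ENNReal.rpow_one] at h2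
      rw [ENNReal.ofReal_pow ENNReal.toReal_nonneg, ENNReal.ofReal_toReal hST]
      exact_mod_cast h2
    have hint : ∀ n < N,
        IntegrableOn (fun x => ∑ l ∈ Finset.Ico n N, h (l + 1) x ^ 2) (Icc 0 1) := by
      intro n hn
      by_contra hcon
      have h1 := hnorm n hn
      rw [IntervalPartition.splineProjSupNorm, dif_neg hcon] at h1
      exact absurd h1 (by simp)
    have hfinal := hC (fun n => F (n + 1)) (fun m n hmn => hF _ _ (by omega) (by omega))
      (fun n => hreg _ (by omega)) f' hf' hfm hfb (fun n => h (n + 1)) (fun n => hh _ (by omega))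
      N hint S.toReal ENNReal.toReal_nonneg hnorm
    calc ∑ n ∈ Finset.range N, ∫⁻ x in Icc (0 : ℝ) 1, ENNReal.ofReal |f' n x * h (n + 1) x|
        = ENNReal.ofReal
            (∑ n ∈ Finset.range N, ∫ x in Icc (0 : ℝ) 1, |f' n x * h (n + 1) x|) := by
          rw [ENNReal.ofReal_sum_of_nonneg fun n _ => integral_nonneg fun x => abs_nonneg _]
          refine Finset.sum_congr rfl fun n _ => ?_
          obtain ⟨B, hB⟩ := hfb n
          exact (ofReal_integral_eq_lintegral_ofReal ((hh (n + 1) (by omega)).bdd_mul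
            (hfm n).aestronglyMeasurable (Filter.Eventually.of_forall hB)).abs
            (Filter.Eventually.of_forall fun x => abs_nonneg _)).symm
      _ ≤ ENNReal.ofReal (C * I * S.toReal) := ENNReal.ofReal_le_ofReal hfinal
      _ = _ := by
          rw [ENNReal.ofReal_mul (by positivity), ENNReal.ofReal_mul hC0.le,
            ENNReal.ofReal_toReal hST, hCI]
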